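/- All rings are commutative with identity and Noetherian. For a ring $R$ and an $R$-module $M$, the trace of $M$ is the ideal $\operatorname{tr}_R(M)=\sum_{\varphi\in\operatorname{Hom}_R(M,R)}\varphi(M)$ of $R$. A canonical module of a Cohen–Macaulay local ring is a maximal Cohen–Macaulay module of type $1$ and of finite injective dimension. A Cohen–Macaulay ring $R$ is called a canonical trace radical (CTR) ring if for every prime ideal $\mathfrak p$ of $R$ the local ring $R_{\mathfrak p}$ has a canonical module $\omega_{R_{\mathfrak p}}$ and $\operatorname{tr}_{R_{\mathfrak p}}(\omega_{R_{\mathfrak p}})$ is a radical ideal of $R_{\mathfrak p}$ (the unit ideal counts as radical). **Proposition.** Let $R$ be a Cohen–Macaulay local ring with canonical module $\omega_R$. Then $R$ is CTR if and only if $\operatorname{tr}_R(\omega_R)$ is a radical ideal of $R$. -/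

import Mathlib

open CategoryTheory

universe u v

namespace CanonicalTrace

/-- The trace of an `R`-module `M`: the sum of the images `φ(M)` over all `R`-linear maps
`φ : M → R`. -/
def traceIdeal (R : Type u) [CommRing R] (M : Type v) [AddCommGroup M] [Module R M] : Ideal R :=
  ⨆ φ : M →ₗ[R] R, LinearMap.range φ

/-- The depth of a nonzero finitely generated module `M` over a Noetherian local ring `(R, 𝔪)`:
the largest length of an `M`-regular sequence contained in `𝔪`. -/
noncomputable def depth (R : Type u) [CommRing R] [IsLocalRing R]
    (M : Type v) [AddCommGroup M] [Module R M] : ℕ∞ :=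
  ⨆ (rs : List R) (_ : (∀ r ∈ rs, r ∈ IsLocalRing.maximalIdeal R) ∧
    RingTheory.Sequence.IsRegular M rs), (rs.length : ℕ∞)

/-- A Cohen–Macaulay local ring: a Noetherian local ring whose depth is its Krull dimension. -/
structure IsCohenMacaulayLocalRing (R : Type u) [CommRing R] [IsLocalRing R] : Prop where
  isNoetherianRing : IsNoetherianRing R
  depth_eq_ringKrullDim : ((depth R R : ℕ∞) : WithBot ℕ∞) = ringKrullDim R

/-- A Cohen–Macaulay ring: a Noetherian ring all of whose localizations at prime ideals are
Cohen–Macaulay local rings. -/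
structure IsCohenMacaulayRing (R : Type u) [CommRing R] : Prop where
  isNoetherianRing : IsNoetherianRing R
  localization_atPrime : ∀ (p : Ideal R) [p.IsPrime],
    IsCohenMacaulayLocalRing (Localization.AtPrime p)

/-- A maximal Cohen–Macaulay module over a local ring: a (nonzero) finitely generated module `M`
with `depth M = dim M = dim R`, where `dim M` is the dimension of the support of `M`. -/
structure IsMaximalCohenMacaulay (R : Type u) [CommRing R] [IsLocalRing R]
    (M : Type v) [AddCommGroup M] [Module R M] : Prop where
  finite : Module.Finite R M
  depth_eq_supportDim : ((depth R M : ℕ∞) : WithBot ℕ∞) = Module.supportDim R M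
  supportDim_eq_ringKrullDim : Module.supportDim R M = ringKrullDim R

/-- The type `r(M) = dim_k Ext^t_R(k, M)`, `t = depth M`, of a finitely generated module `M` over a
local ring `R` with residue field `k`. The `R`-module `Ext^t_R(k, M)` is annihilated by the maximal
ideal, so its dimension as a `k`-vector space is its length as an `R`-module. -/
noncomputable def cmType (R : Type u) [CommRing R] [IsLocalRing R]
    (M : Type u) [AddCommGroup M] [Module R M] : ℕ∞ :=
  Module.length R (Abelian.Ext (ModuleCat.of R (IsLocalRing.ResidueField R)) (ModuleCat.of R M)
    (depth R M).toNat)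

/-- A canonical module of a Cohen–Macaulay local ring `R`: a maximal Cohen–Macaulay `R`-module of
type `1` and of finite injective dimension. -/
structure IsCanonicalModule (R : Type u) [CommRing R] [IsLocalRing R]
    (ω : Type u) [AddCommGroup ω] [Module R ω] : Prop where
  isMaximalCohenMacaulay : IsMaximalCohenMacaulay R ω
  type_eq_one : cmType R ω = 1
  finite_injectiveDimension : ∃ n : ℕ, HasInjectiveDimensionLE (ModuleCat.of R ω) n

/-- A canonical trace radical (CTR) ring: a Cohen–Macaulay ring `R` such that for every prime `p`
the local ring `R_p` has a canonical module whose trace is a radical ideal of `R_p`. -/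
structure IsCTR (R : Type u) [CommRing R] : Prop where
  isCohenMacaulayRing : IsCohenMacaulayRing R
  exists_canonicalModule : ∀ (p : Ideal R) [p.IsPrime],
    ∃ (ω : Type u) (_ : AddCommGroup ω) (_ : Module (Localization.AtPrime p) ω),
      IsCanonicalModule (Localization.AtPrime p) ω ∧
        (traceIdeal (Localization.AtPrime p) ω).IsRadical

end CanonicalTrace

/-! The trace of a finitely presented module commutes with localization, radical ideals stay radical
under localization, and `R → R_𝔪` is an isomorphism. The statement thus reduces to two facts: `ω_𝔭`
is canonical over `R_𝔭` (`IsCanonicalModule.localization`), and all canonical modules of a ring have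
the same trace, for which surjections in both directions suffice
(`IsCanonicalModule.exists_surjective`).

The type does not obviously localize. For a maximal Cohen–Macaulay module of finite injective
dimension it equals `1` exactly when every endomorphism is a homothety, and this condition
localizes.

The engine is the vanishing of `Ext^i(N, ω)` for finite `N` and `i > d = dim R`
(`extVanish_of_hasInjectiveDimensionLE`). If `x` is a sequence of length `d` regular on `R` and `ω`,
then `ω/xω` has finite length, is injective among finite modules killed by `x`, and by Rees `Hom(k,
ω/xω)` has length the type of `ω`. Length counts settle matters for `ω/xω`; since `Ext^i(N, ω) = 0`
for `i > 0` and `N` maximal Cohen–Macaulay, maps lift to `ω`, and Nakayama finishes.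

It remains that `ω_𝔭` is nonzero, because `ω` is faithful
(`annihilator_eq_bot_of_hasInjectiveDimensionLE`), and of full depth, because `𝔭` contains a
sequence regular on `R × ω` of length at least its height (`exists_isWeaklyRegular_height_le`). -/

namespace CanonicalTrace

open Abelian IsLocalRing RingTheory.Sequence Pointwise

/-! ### Vanishing of Ext along short exact sequences -/

section ExtSequences

variable {R : Type u} [CommRing R]

/-- Vanishing of `Ext^i_R(N, M)`. -/
abbrev ExtVanish (R : Type u) [CommRing R] (N M : Type u) [AddCommGroup N] [Module R N]
    [AddCommGroup M] [Module R M] (i : ℕ) : Prop :=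
  Subsingleton (Ext (ModuleCat.of R N) (ModuleCat.of R M) i)

variable {A B C : Type u} [AddCommGroup A] [Module R A] [AddCommGroup B] [Module R B]
  [AddCommGroup C] [Module R C]
variable {M N : Type u} [AddCommGroup M] [Module R M] [AddCommGroup N] [Module R N]

lemma ExtVanish.zero_iff : ExtVanish R N M 0 ↔ Subsingleton (N →ₗ[R] M) :=
  (Ext.addEquiv₀.trans ModuleCat.homAddEquiv).subsingleton_congr

lemma ExtVanish.congr_left (e : A ≃ₗ[R] B) (i : ℕ) (h : ExtVanish R A M i) :
    ExtVanish R B M i := by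
  refine subsingleton_of_forall_eq 0 fun x ↦ ?_
  have h1 : (Ext.mk₀ e.toModuleIso.hom).comp x (zero_add i) = 0 := Subsingleton.elim _ _
  have h2 : (Ext.mk₀ e.toModuleIso.inv).comp
      ((Ext.mk₀ e.toModuleIso.hom).comp x (zero_add i)) (zero_add i) = x := by
    rw [Ext.mk₀_comp_mk₀_assoc, Iso.inv_hom_id, Ext.mk₀_id_comp]
  rw [← h2, h1, Ext.comp_zero]

lemma ExtVanish.congr_right (e : A ≃ₗ[R] B) (i : ℕ) (h : ExtVanish R N A i) :
    ExtVanish R N B i := by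
  refine subsingleton_of_forall_eq 0 fun x ↦ ?_
  have h1 : x.comp (Ext.mk₀ e.toModuleIso.inv) (add_zero i) = 0 := Subsingleton.elim _ _
  have h2 : (x.comp (Ext.mk₀ e.toModuleIso.inv) (add_zero i)).comp
      (Ext.mk₀ e.toModuleIso.hom) (add_zero i) = x := by
    rw [Ext.comp_assoc_of_second_deg_zero, Ext.mk₀_comp_mk₀, Iso.inv_hom_id, Ext.comp_mk₀_id]
  rw [← h2, h1, Ext.zero_comp]

/-- The short complex attached to an exact pair of linear maps. -/
abbrev shortComplexOfExact {f : A →ₗ[R] B} {g : B →ₗ[R] C} (hfg : Function.Exact f g) :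
    ShortComplex (ModuleCat.{u} R) :=
  ModuleCat.shortComplexOfCompEqZero f g hfg.linearMap_comp_eq_zero

variable {f : A →ₗ[R] B} {g : B →ₗ[R] C} (hf : Function.Injective f)
  (hg : Function.Surjective g) (hfg : Function.Exact f g)

include hf hg in
lemma shortExact_of_exact : (shortComplexOfExact hfg).ShortExact :=
  ModuleCat.shortComplex_shortExact _ hfg hf hg

include hf hg hfg

lemma ExtVanish.middle_left {i : ℕ} (h1 : ExtVanish R A M i) (h3 : ExtVanish R C M i) :
    ExtVanish R B M i := by
  refine subsingleton_of_forall_eq 0 fun x ↦ ?_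
  obtain ⟨y, rfl⟩ := Ext.contravariant_sequence_exact₂ (shortExact_of_exact hf hg hfg) _ x
    (Subsingleton.elim (α := Ext (ModuleCat.of R A) (ModuleCat.of R M) i) _ _)
  rw [Subsingleton.elim (α := Ext (ModuleCat.of R C) (ModuleCat.of R M) i) y 0, Ext.comp_zero]

lemma ExtVanish.left_of_middle {i : ℕ} (h2 : ExtVanish R B M i) (h3 : ExtVanish R C M (i + 1)) :
    ExtVanish R A M i := by
  refine subsingleton_of_forall_eq 0 fun x ↦ ?_
  obtain ⟨y, rfl⟩ := Ext.contravariant_sequence_exact₁ (shortExact_of_exact hf hg hfg) _ x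
    (add_comm 1 i) (Subsingleton.elim (α := Ext (ModuleCat.of R C) (ModuleCat.of R M) (i + 1)) _ _)
  rw [Subsingleton.elim (α := Ext (ModuleCat.of R B) (ModuleCat.of R M) i) y 0, Ext.comp_zero]

lemma ExtVanish.middle_right {i : ℕ} (h1 : ExtVanish R N A i) (h3 : ExtVanish R N C i) :
    ExtVanish R N B i := by
  refine subsingleton_of_forall_eq 0 fun x ↦ ?_
  obtain ⟨y, rfl⟩ := Ext.covariant_sequence_exact₂ _ (shortExact_of_exact hf hg hfg) x
    (Subsingleton.elim (α := Ext (ModuleCat.of R N) (ModuleCat.of R C) i) _ _)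
  rw [Subsingleton.elim (α := Ext (ModuleCat.of R N) (ModuleCat.of R A) i) y 0, Ext.zero_comp]

lemma ExtVanish.right_of_middle {i : ℕ} (h2 : ExtVanish R N B i) (h1 : ExtVanish R N A (i + 1)) :
    ExtVanish R N C i := by
  refine subsingleton_of_forall_eq 0 fun x ↦ ?_
  obtain ⟨y, rfl⟩ := Ext.covariant_sequence_exact₃ _ (shortExact_of_exact hf hg hfg) x rfl
    (Subsingleton.elim (α := Ext (ModuleCat.of R N) (ModuleCat.of R A) (i + 1)) _ _)
  rw [Subsingleton.elim (α := Ext (ModuleCat.of R N) (ModuleCat.of R B) i) y 0, Ext.zero_comp]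

lemma exists_lift_of_extVanish (h1 : ExtVanish R N A 1) (φ : N →ₗ[R] C) :
    ∃ ψ : N →ₗ[R] B, g ∘ₗ ψ = φ := by
  obtain ⟨y, hy⟩ := Ext.covariant_sequence_exact₃ _ (shortExact_of_exact hf hg hfg)
    (Ext.mk₀ (ModuleCat.ofHom φ)) (zero_add 1)
    (Subsingleton.elim (α := Ext (ModuleCat.of R N) (ModuleCat.of R A) 1) _ _)
  obtain ⟨ψ, rfl⟩ := (Ext.mk₀_bijective _ _).2 y
  rw [Ext.mk₀_comp_mk₀] at hy
  have := (Ext.mk₀_bijective _ _).1 hy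
  refine ⟨ψ.hom, ?_⟩
  exact congrArg ModuleCat.Hom.hom this

end ExtSequences

/-! ### Finite injective dimension and vanishing of Ext in high degrees -/

section Regular

variable {R : Type u} [CommRing R]
variable {M N : Type u} [AddCommGroup M] [Module R M] [AddCommGroup N] [Module R N]

lemma exact_smul_mkQ (x : R) :
    Function.Exact (LinearMap.lsmul R M x) (x • (⊤ : Submodule R M)).mkQ :=
  LinearMap.exact_lsmul_mkQ_smul_top M x

lemma ExtVanish.quotSMulTop_right {x : R} (hx : IsSMulRegular M x) {i : ℕ}
    (h0 : ExtVanish R N M i) (h1 : ExtVanish R N M (i + 1)) :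
    ExtVanish R N (QuotSMulTop x M) i :=
  .right_of_middle (f := LinearMap.lsmul R M x) hx (Submodule.mkQ_surjective _)
    (exact_smul_mkQ x) h0 h1

variable [IsLocalRing R] [IsNoetherianRing R]

/-- The long exact sequence makes multiplication by `x` surjective on `Ext^i(N, M)`, so Nakayama
kills this Ext. -/
lemma ExtVanish.of_quotSMulTop_left [Module.Finite R N] [Module.Finite R M] {x : R}
    (hx : IsSMulRegular N x) (mem : x ∈ maximalIdeal R) {i : ℕ}
    (h1 : ExtVanish R (QuotSMulTop x N) M (i + 1)) : ExtVanish R N M i := by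
  by_contra ntr
  rw [not_subsingleton_iff_nontrivial] at ntr
  have : x ∈ (Module.annihilator R (Ext (ModuleCat.of R N) (ModuleCat.of R M) i)).jacobson :=
    (IsLocalRing.maximalIdeal_le_jacobson _) mem
  apply Submodule.top_ne_pointwise_smul_of_mem_jacobson_annihilator this
  rw [eq_comm, eq_top_iff]
  intro y _
  obtain ⟨z, hz⟩ := Ext.contravariant_sequence_exact₁
    (shortExact_of_exact (f := LinearMap.lsmul R N x) hx (Submodule.mkQ_surjective _)
      (exact_smul_mkQ x)) _ y (add_comm 1 i)
    (Subsingleton.elim (α := Ext (ModuleCat.of R (QuotSMulTop x N)) (ModuleCat.of R M) (i + 1)) _ _)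
  have h : (shortComplexOfExact (exact_smul_mkQ (M := N) x)).f = x • 𝟙 (ModuleCat.of R N) := rfl
  rw [h, Ext.mk₀_smul, Ext.smul_comp, Ext.mk₀_id_comp] at hz
  rw [← hz]
  exact Submodule.smul_mem_pointwise_smul _ _ ⊤ trivial

/-- A weakly regular sequence of length `s` on `N` shifts the range of vanishing of `Ext(-, M)`. -/
lemma extVanish_of_isWeaklyRegular_left [Module.Finite R M] {d : ℕ}
    (h : ∀ (N : Type u) [AddCommGroup N] [Module R N] [Module.Finite R N] (i : ℕ), d < i →
      ExtVanish R N M i) (rs : List R) (mem : ∀ r ∈ rs, r ∈ maximalIdeal R)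
    (N : Type u) [AddCommGroup N] [Module R N] [Module.Finite R N] (reg : IsWeaklyRegular N rs)
    (i : ℕ) (hi : d < i + rs.length) : ExtVanish R N M i := by
  induction rs generalizing N i with
  | nil => exact h N i hi
  | cons x rs ih =>
    rw [isWeaklyRegular_cons_iff] at reg
    simp only [List.mem_cons, forall_eq_or_imp] at mem
    refine .of_quotSMulTop_left reg.1 mem.1 (ih mem.2 _ reg.2 (i + 1) ?_)
    simp only [List.length_cons] at hi
    lia

/-- If `M` is finite of finite injective dimension and `k` embeds into `R/(rs)` for a regular
sequence `rs`, then `Ext^i(N, M) = 0` for all finite `N` and `i > length rs`. -/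
theorem extVanish_of_hasInjectiveDimensionLE [Module.Finite R M]
    (hM : ∃ n : ℕ, HasInjectiveDimensionLE (ModuleCat.of R M) n) (rs : List R)
    (reg : IsRegular R rs) (ι : ResidueField R →ₗ[R] R ⧸ Ideal.ofList rs)
    (hι : Function.Injective ι) (N : Type u) [AddCommGroup N] [Module R N] [Module.Finite R N]
    (i : ℕ) (hi : rs.length < i) : ExtVanish R N M i := by
  obtain ⟨n, hn⟩ := hM
  have hpd : HasProjectiveDimensionLT (ModuleCat.of R (R ⧸ Ideal.ofList rs)) (rs.length + 1) := by
    have h := ModuleCat.projectiveDimension_quotient_eq_length.{u} rs reg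
    rw [projectiveDimension_eq_of_iso (Shrink.linearEquiv R (R ⧸ Ideal.ofList rs)).toModuleIso] at h
    exact (projectiveDimension_le_iff _ _).mp h.le
  -- Descending induction on the degree: vanishing is automatic from degree `n + 1` on, and `j`
  -- bounds the distance left. Prime filtrations then reduce to `N = R/p`.
  obtain ⟨j, hj⟩ : ∃ j, n + 1 ≤ i + j := ⟨n + 1, by lia⟩
  induction j generalizing i N with
  | zero => exact HasInjectiveDimensionLT.subsingleton _ (n + 1) i hj _
  | succ j ih =>
    replace ih : ∀ (N : Type u) [AddCommGroup N] [Module R N] [Module.Finite R N],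
        ExtVanish R N M (i + 1) := fun N _ _ _ ↦ ih N (i + 1) (by lia) (by lia)
    induction ‹Module.Finite R N› using IsNoetherianRing.induction_on_isQuotientEquivQuotientPrime
      with
    | subsingleton N =>
      exact .congr_left (LinearEquiv.ofSubsingleton PUnit.{u + 1} N : _ ≃ₗ[R] _) i
        (subsingleton_of_forall_eq 0 fun x ↦ by
          rw [← Ext.mk₀_id_comp x, (ModuleCat.isZero_of_subsingleton
            (ModuleCat.of R PUnit)).eq_zero_of_src (𝟙 _), Ext.mk₀_zero, Ext.zero_comp])
    | quotient N p e =>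
      refine .congr_left e.symm i ?_
      by_cases hp : p.asIdeal = maximalIdeal R
      -- For `N = k`, embed `k` in `R/(rs)`, whose Ext vanishes by projective dimension; the
      -- cokernel is handled one degree higher.
      · have h2 : ExtVanish R (R ⧸ Ideal.ofList rs) M i :=
          HasProjectiveDimensionLT.subsingleton _ (rs.length + 1) i hi _
        have := ExtVanish.left_of_middle (M := M) hι (Submodule.mkQ_surjective ι.range)
          (LinearMap.exact_map_mkQ_range ι) h2 (ih _)
        rw [hp]
        exact this
      · obtain ⟨x, hx, hxp⟩ := SetLike.exists_of_lt
          (lt_of_le_of_ne (le_maximalIdeal p.2.ne_top) hp)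
        refine .of_quotSMulTop_left ?_ hx (ih _)
        intro a b hab
        have : IsDomain (R ⧸ p.asIdeal) := inferInstance
        have hx0 : (Ideal.Quotient.mk p.asIdeal x) ≠ 0 := by
          rwa [Ne, Ideal.Quotient.eq_zero_iff_mem]
        simp only [Algebra.smul_def] at hab
        exact mul_left_cancel₀ hx0 hab
    | exact N₁ N₂ N₃ f g hf hg hfg h1 h3 => exact .middle_left hf hg hfg h1 h3

end Regular

/-! ### Hom and Ext modulo a regular sequence; Rees' theorem -/

section HomModRegular

variable {R : Type u} [CommRing R]
variable {M N N' : Type u} [AddCommGroup M] [Module R M] [AddCommGroup N] [Module R N]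
  [AddCommGroup N'] [Module R N']

lemma exists_lift_quotient_ofList (rs : List R) (reg : IsWeaklyRegular M rs)
    (h : ∀ i, ExtVanish R N M (i + 1)) (f : N →ₗ[R] M ⧸ Ideal.ofList rs • (⊤ : Submodule R M)) :
    ∃ g : N →ₗ[R] M, (Ideal.ofList rs • (⊤ : Submodule R M)).mkQ ∘ₗ g = f := by
  induction rs generalizing M with
  | nil =>
    have h0 : Ideal.ofList ([] : List R) • (⊤ : Submodule R M) = ⊥ := by simp
    refine ⟨(Submodule.quotEquivOfEqBot _ h0).toLinearMap ∘ₗ f, ?_⟩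
    ext n
    obtain ⟨m, hm⟩ := Submodule.mkQ_surjective _ (f n)
    simp [← hm]
  | cons x rs ih =>
    rw [isWeaklyRegular_cons_iff] at reg
    let e := Submodule.quotOfListConsSMulTopEquivQuotSMulTopInner M x rs
    obtain ⟨g', hg'⟩ := ih reg.2 (fun i ↦ .quotSMulTop_right reg.1 (h i) (h (i + 1)))
      (e.toLinearMap ∘ₗ f)
    obtain ⟨g, hg⟩ := exists_lift_of_extVanish (f := LinearMap.lsmul R M x) reg.1
      (Submodule.mkQ_surjective _) (exact_smul_mkQ x) (h 0) g'
    refine ⟨g, ?_⟩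
    ext n
    apply e.injective
    have h1 := LinearMap.congr_fun hg' n
    rw [← hg] at h1
    exact h1

/-- Modulo `x`, induction writes `f` as a combination of homomorphisms, which lift because `Ext^1(N,
M) = 0`. The error takes values in `xM` and can be divided by `x`; the quotient is linear since `x`
is a nonzerodivisor on `M`. -/
lemma mem_ofList_smul_hom (rs : List R) (reg : IsWeaklyRegular M rs)
    (h : ∀ i, ExtVanish R N M (i + 1)) (f : N →ₗ[R] M)
    (hf : ∀ n, f n ∈ Ideal.ofList rs • (⊤ : Submodule R M)) :
    f ∈ Ideal.ofList rs • (⊤ : Submodule R (N →ₗ[R] M)) := by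
  induction rs generalizing M with
  | nil =>
    have : f = 0 := by
      ext n
      simpa using hf n
    rw [this]
    exact Submodule.zero_mem _
  | cons x rs ih =>
    rw [isWeaklyRegular_cons_iff] at reg
    let π := (x • (⊤ : Submodule R M)).mkQ
    let c : (N →ₗ[R] M) →ₗ[R] (N →ₗ[R] QuotSMulTop x M) := LinearMap.llcomp R N M _ π
    have hc : Function.Surjective c := fun g' ↦
      exists_lift_of_extVanish (f := LinearMap.lsmul R M x) reg.1
        (Submodule.mkQ_surjective _) (exact_smul_mkQ x) (h 0) g'
    have h1 : c f ∈ Ideal.ofList rs • (⊤ : Submodule R (N →ₗ[R] QuotSMulTop x M)) := by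
      refine ih reg.2 (fun i ↦ .quotSMulTop_right reg.1 (h i) (h (i + 1))) _ fun n ↦ ?_
      let e := Submodule.quotOfListConsSMulTopEquivQuotSMulTopInner M x rs
      have h2 : (Ideal.ofList (x :: rs) • (⊤ : Submodule R M)).mkQ (f n) = 0 := by
        simpa using hf n
      have h3 : e ((Ideal.ofList (x :: rs) • (⊤ : Submodule R M)).mkQ (f n)) = 0 := by
        rw [h2, map_zero]
      exact (Submodule.Quotient.mk_eq_zero _).mp h3
    have h2 : (Ideal.ofList rs • (⊤ : Submodule R (N →ₗ[R] QuotSMulTop x M))) =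
        Submodule.map c (Ideal.ofList rs • ⊤) := by
      rw [Submodule.map_smul'', Submodule.map_top, LinearMap.range_eq_top.mpr hc]
    rw [h2] at h1
    obtain ⟨g, hg, hgf⟩ := h1
    have h3 : ∀ n, ∃ m, x • m = (f - g) n := fun n ↦ by
      have h4 : π (f n - g n) = 0 := by
        rw [map_sub, sub_eq_zero]
        exact (LinearMap.congr_fun hgf n).symm
      have h5 : f n - g n ∈ x • (⊤ : Submodule R M) := (Submodule.Quotient.mk_eq_zero _).mp h4
      obtain ⟨m, -, hm⟩ := (Submodule.mem_smul_pointwise_iff_exists _ _ _).mp h5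
      exact ⟨m, hm⟩
    choose q hq using h3
    let q' : N →ₗ[R] M :=
      { toFun := q
        map_add' := fun a b ↦ reg.1 (by
          change x • q (a + b) = x • (q a + q b)
          rw [smul_add, hq, hq, hq, map_add])
        map_smul' := fun r a ↦ reg.1 (by
          change x • q (r • a) = x • (r • q a)
          rw [smul_comm, hq, hq, map_smul]) }
    have h6 : f = x • q' + g := by
      ext n
      have := hq n
      simp only [LinearMap.sub_apply] at this
      change f n = x • q n + g n
      rw [this]; abel
    rw [h6, Ideal.ofList_cons, Submodule.sup_smul]
    exact Submodule.add_mem_sup (Submodule.smul_mem_smul (Ideal.mem_span_singleton_self x) trivial)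
      hg

lemma smul_ext_eq_zero {x : R} (hx : x ∈ Module.annihilator R N) {i : ℕ}
    (e : Ext (ModuleCat.of R N) (ModuleCat.of R M) i) : x • e = 0 := by
  have h : x • 𝟙 (ModuleCat.of R N) = 0 := by
    ext n
    exact Module.mem_annihilator.mp hx n
  rw [← Ext.mk₀_id_comp e, ← Ext.smul_comp, ← Ext.mk₀_smul, h, Ext.mk₀_zero, Ext.zero_comp]

lemma comp_mk₀_lsmul {x : R} (hx : x ∈ Module.annihilator R N) {i : ℕ}
    (e : Ext (ModuleCat.of R N) (ModuleCat.of R M) i) :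
    e.comp (Ext.mk₀ (shortComplexOfExact (exact_smul_mkQ (M := M) x)).f) (add_zero i) = 0 := by
  have h : (shortComplexOfExact (exact_smul_mkQ (M := M) x)).f = x • 𝟙 (ModuleCat.of R M) := rfl
  rw [h, Ext.mk₀_smul, Ext.comp_smul, Ext.comp_mk₀_id, smul_ext_eq_zero hx]

lemma shortExact_smul {x : R} (hx : IsSMulRegular M x) :
    (shortComplexOfExact (exact_smul_mkQ (M := M) x)).ShortExact :=
  shortExact_of_exact (f := LinearMap.lsmul R M x) hx (Submodule.mkQ_surjective _)
    (exact_smul_mkQ x)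

/-- Since `x` kills `N` it kills `Ext(N, M)`, so the connecting map from `Ext^i(N, M/xM)` onto
`Ext^(i+1)(N, M)` is surjective. -/
lemma extVanish_of_isWeaklyRegular_right (rs : List R) (reg : IsWeaklyRegular M rs)
    (ann : ∀ r ∈ rs, r ∈ Module.annihilator R N) (i : ℕ) (hi : i < rs.length) :
    ExtVanish R N M i := by
  induction rs generalizing M i with
  | nil => simp at hi
  | cons x rs ih =>
    rw [isWeaklyRegular_cons_iff] at reg
    simp only [List.mem_cons, forall_eq_or_imp] at ann
    cases i with
    | zero =>
      rw [ExtVanish.zero_iff]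
      exact IsSMulRegular.linearMap_subsingleton_of_mem_annihilator reg.1 ann.1
    | succ i =>
      have := ih reg.2 ann.2 i (by simpa using hi)
      refine subsingleton_of_forall_eq 0 fun y ↦ ?_
      obtain ⟨z, rfl⟩ := Ext.covariant_sequence_exact₁ _ (shortExact_smul reg.1) y
        (comp_mk₀_lsmul ann.1 y) rfl
      rw [Subsingleton.elim (α := Ext (ModuleCat.of R N) (ModuleCat.of R (QuotSMulTop x M)) i)
        z 0, Ext.zero_comp]

/-- Rees' change of degree isomorphism. -/
lemma nonempty_linearEquiv_hom_quotient_ext (rs : List R) (reg : IsWeaklyRegular M rs)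
    (ann : ∀ r ∈ rs, r ∈ Module.annihilator R N) :
    Nonempty ((N →ₗ[R] M ⧸ Ideal.ofList rs • (⊤ : Submodule R M)) ≃ₗ[R]
      Ext (ModuleCat.of R N) (ModuleCat.of R M) rs.length) := by
  induction rs generalizing M with
  | nil =>
    have h0 : Ideal.ofList ([] : List R) • (⊤ : Submodule R M) = ⊥ := by simp
    let e₀ : (N →ₗ[R] M ⧸ Ideal.ofList ([] : List R) • (⊤ : Submodule R M)) ≃ₗ[R] (N →ₗ[R] M) :=
      LinearEquiv.congrRight (Submodule.quotEquivOfEqBot _ h0)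
    let e₁ : Ext (ModuleCat.of R N) (ModuleCat.of R M) 0 ≃ₗ[R] (N →ₗ[R] M) :=
      Ext.linearEquiv₀.trans ModuleCat.homLinearEquiv
    exact ⟨e₀.trans e₁.symm⟩
  | cons x rs ih =>
    have hv := extVanish_of_isWeaklyRegular_right (x :: rs) reg ann rs.length (by simp)
    rw [isWeaklyRegular_cons_iff] at reg
    simp only [List.mem_cons, forall_eq_or_imp] at ann
    obtain ⟨e⟩ := ih reg.2 ann.2
    let e₀ : (N →ₗ[R] M ⧸ Ideal.ofList (x :: rs) • (⊤ : Submodule R M)) ≃ₗ[R]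
        (N →ₗ[R] QuotSMulTop x M ⧸ Ideal.ofList rs • (⊤ : Submodule R (QuotSMulTop x M))) :=
      LinearEquiv.congrRight (Submodule.quotOfListConsSMulTopEquivQuotSMulTopInner M x rs)
    let hS := shortExact_smul reg.1
    let δ := (Ext.bilinearCompOfLinear R (ModuleCat.of R N) _ _ rs.length 1
      (rs.length + 1) rfl).flip hS.extClass
    -- The connecting map is injective because the Ext of `M` one degree lower vanishes, and
    -- surjective because `x` kills Ext.
    suffices hδ : Function.Bijective δ from ⟨(e₀.trans e).trans (LinearEquiv.ofBijective δ hδ)⟩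
    refine ⟨?_, ?_⟩
    · rw [injective_iff_map_eq_zero]
      intro y hy
      obtain ⟨z, rfl⟩ := Ext.covariant_sequence_exact₃ _ hS y rfl hy
      rw [Subsingleton.elim (α := Ext (ModuleCat.of R N) (ModuleCat.of R M) rs.length)
        z 0, Ext.zero_comp]
    · intro y
      exact Ext.covariant_sequence_exact₁ _ hS y (comp_mk₀_lsmul ann.1 y) rfl

/-- This carries Rees' isomorphism together with its naturality in the first argument: extending
maps along `j` becomes extending Ext classes. -/
lemma exists_extension_of_ext_extension (rs : List R) (reg : IsWeaklyRegular M rs)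
    (ann : ∀ r ∈ rs, r ∈ Module.annihilator R N) (ann' : ∀ r ∈ rs, r ∈ Module.annihilator R N')
    (j : N' →ₗ[R] N)
    (h : ∀ a : Ext (ModuleCat.of R N') (ModuleCat.of R M) rs.length,
      ∃ b : Ext (ModuleCat.of R N) (ModuleCat.of R M) rs.length,
        (Ext.mk₀ (ModuleCat.ofHom j)).comp b (zero_add _) = a)
    (f : N' →ₗ[R] M ⧸ Ideal.ofList rs • (⊤ : Submodule R M)) :
    ∃ g : N →ₗ[R] M ⧸ Ideal.ofList rs • (⊤ : Submodule R M), g ∘ₗ j = f := by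
  induction rs generalizing M with
  | nil =>
    have h0 : Ideal.ofList ([] : List R) • (⊤ : Submodule R M) = ⊥ := by simp
    let e := Submodule.quotEquivOfEqBot _ h0
    obtain ⟨b, hb⟩ := h (Ext.mk₀ (ModuleCat.ofHom (e.toLinearMap ∘ₗ f)))
    obtain ⟨g, rfl⟩ := (Ext.mk₀_bijective _ _).2 b
    rw [Ext.mk₀_comp_mk₀] at hb
    have hb' := congrArg ModuleCat.Hom.hom ((Ext.mk₀_bijective _ _).1 hb)
    refine ⟨e.symm.toLinearMap ∘ₗ g.hom, ?_⟩
    ext n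
    apply e.injective
    simpa using LinearMap.congr_fun hb' n
  | cons x rs ih =>
    have hv := extVanish_of_isWeaklyRegular_right (x :: rs) reg ann' rs.length (by simp)
    rw [isWeaklyRegular_cons_iff] at reg
    simp only [List.mem_cons, forall_eq_or_imp] at ann ann'
    let e := Submodule.quotOfListConsSMulTopEquivQuotSMulTopInner M x rs
    let hS := shortExact_smul reg.1
    obtain ⟨g, hg⟩ := ih reg.2 ann.2 ann'.2 (fun a ↦ by
      obtain ⟨b, hb⟩ := h (a.comp hS.extClass rfl)
      obtain ⟨c, rfl⟩ := Ext.covariant_sequence_exact₁ _ hS b (comp_mk₀_lsmul ann.1 b) rfl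
      refine ⟨c, ?_⟩
      -- The restriction of `c` and the class `a` have the same image under the connecting map for
      -- `N'`, which is injective by `hv`.
      have hsub : ((Ext.mk₀ (ModuleCat.ofHom j)).comp c (zero_add _) - a).comp hS.extClass rfl
          = 0 := by
        rw [sub_eq_add_neg, Ext.add_comp, Ext.neg_comp, ← hb, ← sub_eq_add_neg, sub_eq_zero]
        exact Ext.comp_assoc _ _ _ _ _ (by simp)
      obtain ⟨z, hz⟩ := Ext.covariant_sequence_exact₃ _ hS _ rfl hsub
      rw [Subsingleton.elim (α := Ext (ModuleCat.of R N') (ModuleCat.of R M) rs.length)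
        z 0, Ext.zero_comp] at hz
      exact (sub_eq_zero.mp hz.symm)) (e.toLinearMap ∘ₗ f)
    refine ⟨e.symm.toLinearMap ∘ₗ g, ?_⟩
    ext n
    apply e.injective
    simpa using LinearMap.congr_fun hg n

/-- `E` is injective with respect to finite modules annihilated by `I`. -/
def IsInjectiveModulo (I : Ideal R) (E : Type u) [AddCommGroup E] [Module R E] : Prop :=
  ∀ (N' N : Type u) [AddCommGroup N'] [Module R N'] [AddCommGroup N] [Module R N]
    [Module.Finite R N] (_ : I ≤ Module.annihilator R N) (j : N' →ₗ[R] N)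
    (_ : Function.Injective j) (f : N' →ₗ[R] E), ∃ g : N →ₗ[R] E, g ∘ₗ j = f

/-- After the shift to Ext, the obstruction to extending lies in `Ext^(length + 1)(N/N', M)`, which
is zero. -/
lemma isInjectiveModulo_quotient_ofList (rs : List R) (reg : IsWeaklyRegular M rs)
    (h : ∀ (N : Type u) [AddCommGroup N] [Module R N] [Module.Finite R N],
      ExtVanish R N M (rs.length + 1)) :
    IsInjectiveModulo (Ideal.ofList rs) (M ⧸ Ideal.ofList rs • (⊤ : Submodule R M)) := by
  intro N' N _ _ _ _ _ hI j hj f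
  have ann : ∀ r ∈ rs, r ∈ Module.annihilator R N := fun r hr ↦ hI (Ideal.subset_span hr)
  have ann' : ∀ r ∈ rs, r ∈ Module.annihilator R N' := fun r hr ↦
    LinearMap.annihilator_le_of_injective j hj (ann r hr)
  refine exists_extension_of_ext_extension rs reg ann ann' j (fun a ↦ ?_) f
  have := h (N ⧸ j.range)
  exact Ext.contravariant_sequence_exact₁
    (shortExact_of_exact hj (Submodule.mkQ_surjective _) (LinearMap.exact_map_mkQ_range j)) _ a
    (add_comm 1 _) (Subsingleton.elim
      (α := Ext (ModuleCat.of R (N ⧸ j.range)) (ModuleCat.of R M) (rs.length + 1)) _ _)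

end HomModRegular

/-! ### Finite length modules with simple socle -/

section SimpleSocle

variable {R : Type u} [CommRing R] [IsLocalRing R]

lemma nonempty_linearEquiv_residueField {N : Type v} [AddCommGroup N] [Module R N]
    [IsSimpleModule R N] : Nonempty (N ≃ₗ[R] ResidueField R) := by
  obtain ⟨J, hJ, ⟨e⟩⟩ := isSimpleModule_iff_quot_maximal.mp ‹IsSimpleModule R N›
  obtain rfl := IsLocalRing.eq_maximalIdeal hJ
  exact ⟨e⟩

instance isSimpleModule_residueField : IsSimpleModule R (ResidueField R) :=
  isSimpleModule_iff_quot_maximal.mpr ⟨maximalIdeal R, inferInstance, ⟨LinearEquiv.refl R _⟩⟩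

lemma exists_residueField_injective {E : Type v} [AddCommGroup E] [Module R E] [IsArtinian R E]
    [Nontrivial E] : ∃ ι : ResidueField R →ₗ[R] E, Function.Injective ι := by
  obtain ⟨S, hS⟩ := IsAtomic.exists_atom (Submodule R E)
  have := isSimpleModule_iff_isAtom.mpr hS
  obtain ⟨e⟩ := nonempty_linearEquiv_residueField (R := R) (N := S)
  exact ⟨S.subtype ∘ₗ e.symm.toLinearMap, S.subtype_injective.comp e.symm.injective⟩

lemma length_le_add_of_exact {R : Type*} [Ring R] {A B C : Type*} [AddCommGroup A] [Module R A] [AddCommGroup B]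
    [Module R B] [AddCommGroup C] [Module R C] {f : A →ₗ[R] B} {g : B →ₗ[R] C}
    (h : g.ker ≤ f.range) : Module.length R B ≤ Module.length R A + Module.length R C := by
  rw [Module.length_eq_add_of_exact g.ker.subtype g.rangeRestrict g.ker.subtype_injective
    g.surjective_rangeRestrict (by
      intro x
      simp [← LinearMap.mem_ker])]
  refine add_le_add ?_ (Module.length_le_of_injective _ g.range.subtype_injective)
  exact (Module.length_le_of_injective _ (Submodule.inclusion_injective h)).trans
    (Module.length_le_of_surjective f.rangeRestrict f.surjective_rangeRestrict)

/-- `Hom(-, E)` is left exact, so each simple factor of `N` contributes at most `1`. -/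
lemma length_hom_le {E : Type v} [AddCommGroup E] [Module R E]
    (hE : Module.length R (ResidueField R →ₗ[R] E) ≤ 1) (N : Type*) [AddCommGroup N] [Module R N]
    (hN : IsFiniteLength R N) : Module.length R (N →ₗ[R] E) ≤ Module.length R N := by
  induction hN with
  | of_subsingleton => simp
  | @of_simple_quotient N _ _ N' _ _ ih =>
    obtain ⟨e⟩ := nonempty_linearEquiv_residueField (R := R) (N := N ⧸ N')
    have h1 : Module.length R ((N ⧸ N') →ₗ[R] E) ≤ 1 := by
      rwa [(LinearEquiv.congrLeft E R e).length_eq]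
    have h2 := length_le_add_of_exact (f := LinearMap.lcomp R E N'.mkQ)
      (g := LinearMap.lcomp R E N'.subtype) (by
        intro φ hφ
        refine ⟨N'.liftQ φ fun n hn ↦ ?_, by ext; simp⟩
        exact LinearMap.congr_fun (LinearMap.mem_ker.mp hφ) ⟨n, hn⟩)
    have h3 := Module.length_eq_add_of_exact N'.subtype N'.mkQ N'.subtype_injective
      N'.mkQ_surjective (LinearMap.exact_subtype_mkQ N')
    have h4 : Module.length R (N ⧸ N') = 1 := Module.length_eq_one_iff.mpr inferInstance
    rw [h3, h4, add_comm]
    exact h2.trans (add_le_add h1 ih)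

lemma submodule_eq_top_of_length_le {R N : Type*} [Ring R] [AddCommGroup N] [Module R N]
    (S : Submodule R N) (hN : Module.length R N ≠ ⊤) (h : Module.length R N ≤ Module.length R S) :
    S = ⊤ := by
  have h3 := Module.length_eq_add_of_exact S.subtype S.mkQ S.subtype_injective
      S.mkQ_surjective (LinearMap.exact_subtype_mkQ S)
  have h4 : Module.length R (N ⧸ S) = 0 := by
    have h5 : Module.length R S ≠ ⊤ := ne_top_of_le_ne_top hN
      (Module.length_le_of_injective _ S.subtype_injective)
    have h6 : Module.length R S + Module.length R (N ⧸ S) ≤ Module.length R S + 0 := by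
      rw [← h3, add_zero]; exact h
    exact nonpos_iff_eq_zero.mp ((ENat.add_le_add_iff_left h5).mp h6)
  rw [Module.length_eq_zero_iff] at h4
  exact Submodule.Quotient.subsingleton_iff.mp h4

lemma surjective_of_injective_of_length_le {R A B : Type*} [Ring R] [AddCommGroup A] [Module R A]
    [AddCommGroup B] [Module R B] (f : A →ₗ[R] B) (hf : Function.Injective f)
    (hB : Module.length R B ≠ ⊤) (h : Module.length R B ≤ Module.length R A) :
    Function.Surjective f := by
  rw [← LinearMap.range_eq_top]
  exact submodule_eq_top_of_length_le _ hB (h.trans_eq (LinearEquiv.ofInjective f hf).length_eq)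

/-- Over a local ring, every endomorphism of a module of finite length with simple socle is a
homothety. -/
theorem exists_eq_smul_id_of_length_hom_le {E : Type v} [AddCommGroup E] [Module R E]
    (hE : Module.length R (ResidueField R →ₗ[R] E) ≤ 1) (hfin : IsFiniteLength R E)
    (f : E →ₗ[R] E) : ∃ c : R, f = c • LinearMap.id := by
  have h1 := length_hom_le hE E hfin
  have hEfin : Module.length R E ≠ ⊤ := Module.length_ne_top_iff.mpr hfin
  -- The image of `R` in `End E` is `R/ann E`, and `ℓ(End E) ≤ ℓ(E) ≤ ℓ(Hom(R/ann E, E)) ≤ ℓ(R/ann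
  -- E)`, so it is everything. The middle inequality sends `e` to the map `1 ↦ e`.
  let φ : R →ₗ[R] (E →ₗ[R] E) := LinearMap.toSpanSingleton R _ LinearMap.id
  have hker : φ.ker = Module.annihilator R E := by
    ext r
    rw [LinearMap.mem_ker, Module.mem_annihilator, LinearMap.ext_iff]
    rfl
  have hQ : Module.length R (R ⧸ φ.ker) = Module.length R φ.range :=
    φ.quotKerEquivRange.length_eq
  have hQfin : Module.length R (R ⧸ φ.ker) ≠ ⊤ := by
    rw [hQ]
    exact ne_top_of_le_ne_top hEfin
      ((Module.length_le_of_injective _ φ.range.subtype_injective).trans h1)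
  have h2 : Module.length R E ≤ Module.length R (R ⧸ φ.ker) := by
    refine le_trans ?_ (length_hom_le hE _ (Module.length_ne_top_iff.mp hQfin))
    let ψ : E →ₗ[R] ((R ⧸ φ.ker) →ₗ[R] E) :=
      { toFun := fun e ↦ Submodule.liftQ _ (LinearMap.toSpanSingleton R E e) (by
          rw [hker]
          intro r hr
          exact Module.mem_annihilator.mp hr e)
        map_add' := fun a b ↦ Submodule.linearMap_qext _ <| LinearMap.ext_ring <| by
          change (1 : R) • (a + b) = (1 : R) • a + (1 : R) • b
          rw [smul_add]
        map_smul' := fun a b ↦ Submodule.linearMap_qext _ <| LinearMap.ext_ring <| by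
          change (1 : R) • (a • b) = a • ((1 : R) • b)
          rw [smul_comm] }
    refine Module.length_le_of_injective ψ fun a b hab ↦ ?_
    have h : (1 : R) • a = (1 : R) • b := LinearMap.congr_fun hab (Submodule.Quotient.mk 1)
    rwa [one_smul, one_smul] at h
  have h3 : φ.range = ⊤ := submodule_eq_top_of_length_le _ (ne_top_of_le_ne_top hEfin h1)
    (h1.trans (h2.trans_eq hQ))
  obtain ⟨c, hc⟩ : f ∈ φ.range := h3 ▸ trivial
  exact ⟨c, hc.symm⟩

end SimpleSocle

/-! ### Modules injective modulo an ideal -/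

section InjectiveModulo

variable {R : Type u} [CommRing R] [IsLocalRing R] {I : Ideal R}
variable {E E' : Type u} [AddCommGroup E] [Module R E] [AddCommGroup E'] [Module R E']

lemma le_annihilator_quotient_smul_top {R : Type u} [CommRing R] (I : Ideal R) (M : Type u) [AddCommGroup M] [Module R M] :
    I ≤ Module.annihilator R (M ⧸ I • (⊤ : Submodule R M)) := by
  intro r hr
  rw [Module.mem_annihilator]
  intro m
  obtain ⟨m, rfl⟩ := Submodule.mkQ_surjective _ m
  rw [← map_smul]
  exact (Submodule.Quotient.mk_eq_zero _).mpr (Submodule.smul_mem_smul hr trivial)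

/-- If `a ∉ I` kills `E`, the submodule of `R/I` generated by `a` maps onto `k`, hence nontrivially
to `E`. An extension to `R/I` sends `a` to `a` times the image of `1`, which is zero: a
contradiction. -/
lemma annihilator_le_of_isInjectiveModulo [IsArtinian R E] [Nontrivial E]
    (hE : IsInjectiveModulo I E) : Module.annihilator R E ≤ I := by
  intro a ha
  by_contra haI
  obtain ⟨ι, hι⟩ := exists_residueField_injective (R := R) (E := E)
  let s : R →ₗ[R] R ⧸ I := LinearMap.toSpanSingleton R _ (Submodule.Quotient.mk a)
  let N' := s.range
  let t : R →ₗ[R] N' := s.rangeRestrict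
  have hker : t.ker ≤ maximalIdeal R := by
    apply le_maximalIdeal
    intro h
    have h1 : (1 : R) ∈ t.ker := h ▸ trivial
    apply haI
    have h2 : s 1 = 0 := congrArg Subtype.val (LinearMap.mem_ker.mp h1)
    have h3 : (Submodule.Quotient.mk a : R ⧸ I) = 0 := by simpa [s] using h2
    exact (Submodule.Quotient.mk_eq_zero _).mp h3
  let q : N' →ₗ[R] ResidueField R :=
    (t.ker.liftQ (Submodule.mkQ (maximalIdeal R)) (fun _ hr ↦
      (Submodule.Quotient.mk_eq_zero _).mpr (hker hr))) ∘ₗ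
      (t.quotKerEquivOfSurjective s.surjective_rangeRestrict).symm.toLinearMap
  have hq : q (t 1) ≠ 0 := by
    have h1 : (t.quotKerEquivOfSurjective s.surjective_rangeRestrict).symm (t 1)
        = Submodule.Quotient.mk 1 := by
      rw [LinearEquiv.symm_apply_eq]
      rfl
    have h2 : q (t 1) = Submodule.mkQ (maximalIdeal R) 1 := by
      simp only [q, LinearMap.comp_apply, LinearEquiv.coe_coe, h1]
      rfl
    rw [h2]
    intro h3
    have h4 : (1 : R) ∈ maximalIdeal R := (Submodule.Quotient.mk_eq_zero _).mp h3
    exact (Ideal.ne_top_iff_one _).mp (maximalIdeal.isMaximal R).ne_top h4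
  obtain ⟨g, hg⟩ := hE N' (R ⧸ I) (by rw [Ideal.annihilator_quotient]) N'.subtype
    N'.subtype_injective (ι ∘ₗ q)
  have h1 := LinearMap.congr_fun hg (t 1)
  have h2 : N'.subtype (t 1) = a • (Submodule.Quotient.mk 1 : R ⧸ I) := by
    change s 1 = _
    rw [← Submodule.Quotient.mk_smul]
    simp [s]
  rw [LinearMap.comp_apply, h2, map_smul, Module.mem_annihilator.mp ha] at h1
  exact hq (hι (by rw [map_zero]; exact h1.symm))

/-- Extend an isomorphism of the simple socles. A nonzero kernel would contain a copy of `k`, hence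
meet the socle, where the map is injective. -/
lemma exists_injective_of_isInjectiveModulo [Module.Finite R E] [IsArtinian R E]
    (hIE : I ≤ Module.annihilator R E)
    (hE : Module.length R (ResidueField R →ₗ[R] E) = 1)
    (hE' : Module.length R (ResidueField R →ₗ[R] E') = 1) (hinj : IsInjectiveModulo I E') :
    ∃ g : E →ₗ[R] E', Function.Injective g := by
  rw [Module.length_eq_one_iff] at hE hE'
  have := hE.nontrivial
  have := hE'.nontrivial
  obtain ⟨ι, hι0⟩ := exists_ne (0 : ResidueField R →ₗ[R] E)
  obtain ⟨ι', hι0'⟩ := exists_ne (0 : ResidueField R →ₗ[R] E')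
  have hι := ι.injective_or_eq_zero.resolve_right hι0
  have hι' := ι'.injective_or_eq_zero.resolve_right hι0'
  obtain ⟨g, hg⟩ := hinj _ E hIE ι hι ι'
  refine ⟨g, ?_⟩
  rw [← LinearMap.ker_eq_bot]
  by_contra hker
  have : Nontrivial g.ker := Submodule.nontrivial_iff_ne_bot.mpr hker
  obtain ⟨j, hj⟩ := exists_residueField_injective (R := R) (E := g.ker)
  obtain ⟨r, hr⟩ := (IsSimpleModule.toSpanSingleton_surjective R hι0) (g.ker.subtype ∘ₗ j)
  have h1 : ∀ x, r • x = (0 : ResidueField R) := fun x ↦ by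
    apply hι'
    rw [← hg, map_zero, LinearMap.comp_apply, map_smul]
    have h2 : r • ι x = g.ker.subtype (j x) := LinearMap.congr_fun hr x
    rw [h2]
    exact LinearMap.mem_ker.mp (j x).2
  have h3 : j 1 = 0 := by
    apply g.ker.subtype_injective
    have h2 : r • ι 1 = g.ker.subtype (j 1) := LinearMap.congr_fun hr 1
    rw [← h2, ← map_smul, h1, map_zero, map_zero]
  exact one_ne_zero (hj (h3.trans (map_zero j).symm))

lemma exists_surjective_of_isInjectiveModulo (hfE : IsFiniteLength R E)
    (hfE' : IsFiniteLength R E')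
    (hIE : I ≤ Module.annihilator R E) (hIE' : I ≤ Module.annihilator R E')
    (hE : Module.length R (ResidueField R →ₗ[R] E) = 1)
    (hE' : Module.length R (ResidueField R →ₗ[R] E') = 1) (hinj : IsInjectiveModulo I E)
    (hinj' : IsInjectiveModulo I E') :
    ∃ g : E →ₗ[R] E', Function.Surjective g := by
  obtain ⟨_, _⟩ := isFiniteLength_iff_isNoetherian_isArtinian.mp hfE
  obtain ⟨_, _⟩ := isFiniteLength_iff_isNoetherian_isArtinian.mp hfE'
  obtain ⟨g, hg⟩ := exists_injective_of_isInjectiveModulo hIE hE hE' hinj'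
  obtain ⟨g', hg'⟩ := exists_injective_of_isInjectiveModulo hIE' hE' hE hinj
  exact ⟨g, surjective_of_injective_of_length_le g hg (Module.length_ne_top_iff.mpr hfE')
    (Module.length_le_of_injective g' hg')⟩

/-- By injectivity any two nonzero maps `k → E` differ by an endomorphism of `E`, hence by a scalar.
-/
lemma length_hom_residueField_eq_one [Module.Finite R E] [IsArtinian R E] [Nontrivial E]
    (hIE : I ≤ Module.annihilator R E) (hinj : IsInjectiveModulo I E)
    (hend : ∀ f : E →ₗ[R] E, ∃ c : R, f = c • LinearMap.id) :
    Module.length R (ResidueField R →ₗ[R] E) = 1 := by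
  rw [Module.length_eq_one_iff, isSimpleModule_iff_toSpanSingleton_surjective]
  obtain ⟨ι, hι⟩ := exists_residueField_injective (R := R) (E := E)
  refine ⟨⟨ι, 0, fun h ↦ one_ne_zero (hι (by simp [h]))⟩, fun φ hφ ψ ↦ ?_⟩
  obtain ⟨g, hg⟩ := hinj _ E hIE φ (φ.injective_or_eq_zero.resolve_right hφ) ψ
  obtain ⟨c, rfl⟩ := hend g
  refine ⟨c, ?_⟩
  rw [← hg]
  ext x
  rfl

end InjectiveModulo

/-! ### Regular sequences on products and their factors -/

section Retract

variable {R : Type u} [CommRing R]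

/-- A sequence regular on several modules at once is found on their product; the factors are
retracts of it. -/
lemma isWeaklyRegular_of_retract {A M : Type v} [AddCommGroup A] [Module R A] [AddCommGroup M]
    [Module R M] (s : A →ₗ[R] M) (π : M →ₗ[R] A) (h : π ∘ₗ s = LinearMap.id) (rs : List R)
    (reg : IsWeaklyRegular M rs) : IsWeaklyRegular A rs := by
  induction rs generalizing A M with
  | nil => simp
  | cons x rs ih =>
    rw [isWeaklyRegular_cons_iff] at reg ⊢
    refine ⟨fun a b hab ↦ ?_, ih (QuotSMulTop.map x s) (QuotSMulTop.map x π) ?_ reg.2⟩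
    · have h1 : s a = s b := reg.1 (by simpa using congrArg s hab)
      have h2 := congrArg π h1
      rwa [← LinearMap.comp_apply, ← LinearMap.comp_apply, h] at h2
    · rw [← QuotSMulTop.map_comp, h, QuotSMulTop.map_id]

variable {A B : Type v} [AddCommGroup A] [Module R A] [AddCommGroup B] [Module R B]

lemma isWeaklyRegular_fst {rs : List R} (reg : IsWeaklyRegular (A × B) rs) :
    IsWeaklyRegular A rs :=
  isWeaklyRegular_of_retract (.inl R A B) (.fst R A B) (by ext; rfl) rs reg

lemma isWeaklyRegular_snd {rs : List R} (reg : IsWeaklyRegular (A × B) rs) :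
    IsWeaklyRegular B rs :=
  isWeaklyRegular_of_retract (.inr R A B) (.snd R A B) (by ext; rfl) rs reg

lemma ExtVanish.prod {A B N : Type u} [AddCommGroup A] [Module R A] [AddCommGroup B] [Module R B]
    [AddCommGroup N] [Module R N] {i : ℕ} (hA : ExtVanish R N A i) (hB : ExtVanish R N B i) :
    ExtVanish R N (A × B) i :=
  .middle_right (f := .inl R A B) (g := .snd R A B) LinearMap.inl_injective
    LinearMap.snd_surjective .inl_snd hA hB

lemma extVanish_quotient_ofList {M N : Type u} [AddCommGroup M] [Module R M] [AddCommGroup N]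
    [Module R N] (rs : List R) (reg : IsWeaklyRegular M rs) (s : ℕ)
    (h : ∀ i < rs.length + s, ExtVanish R N M i) (i : ℕ) (hi : i < s) :
    ExtVanish R N (M ⧸ Ideal.ofList rs • (⊤ : Submodule R M)) i := by
  induction rs generalizing M with
  | nil =>
    have h0 : Ideal.ofList ([] : List R) • (⊤ : Submodule R M) = ⊥ := by simp
    exact .congr_right (Submodule.quotEquivOfEqBot _ h0).symm i (h i (by simpa using hi))
  | cons x rs ih =>
    rw [isWeaklyRegular_cons_iff] at reg
    simp only [List.length_cons] at h
    exact .congr_right (Submodule.quotOfListConsSMulTopEquivQuotSMulTopInner M x rs).symm i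
      (ih reg.2 fun i hi ↦ .quotSMulTop_right reg.1 (h i (by lia)) (h (i + 1) (by lia)))

end Retract

/-! ### Depth, dimension and the Ext criterion -/

section Depth

variable {R : Type u} [CommRing R] [IsLocalRing R]

lemma mem_annihilator_residueField {r : R} (hr : r ∈ maximalIdeal R) :
    r ∈ Module.annihilator R (ResidueField R) := by
  rw [Module.mem_annihilator]
  intro m
  rw [Algebra.smul_def, ResidueField.algebraMap_eq, (residue_eq_zero_iff r).mpr hr, zero_mul]

lemma support_residueField :
    Module.support R (ResidueField R) = PrimeSpectrum.zeroLocus (maximalIdeal R : Set R) := by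
  rw [Module.support_eq_zeroLocus]
  congr
  exact Ideal.annihilator_quotient

lemma extVanish_residueField {M : Type u} [AddCommGroup M] [Module R M] (rs : List R)
    (mem : ∀ r ∈ rs, r ∈ maximalIdeal R) (reg : IsWeaklyRegular M rs) (i : ℕ)
    (hi : i < rs.length) : ExtVanish R (ResidueField R) M i :=
  extVanish_of_isWeaklyRegular_right rs reg (fun r hr ↦ mem_annihilator_residueField (mem r hr))
    i hi

variable [IsNoetherianRing R]

/-- The support of `k` is also the zero locus of `𝔪^n`, so the sequence may be taken in any positive
power of `𝔪`; large powers serve to prove faithfulness. -/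
lemma exists_isRegular_of_extVanish (M : Type u) [AddCommGroup M] [Module R M] [Module.Finite R M]
    [Nontrivial M] (d n : ℕ) (hn : n ≠ 0) (h : ∀ i < d, ExtVanish R (ResidueField R) M i) :
    ∃ rs : List R, rs.length = d ∧ (∀ r ∈ rs, r ∈ maximalIdeal R ^ n) ∧ IsRegular M rs := by
  have : Module.Finite R (ResidueField R) :=
    inferInstanceAs (Module.Finite R (R ⧸ maximalIdeal R))
  refine ModuleCat.exists_isRegular_of_exists_subsingleton_ext (maximalIdeal R ^ n) d
    (ModuleCat.of R M) ?_ (ModuleCat.of R (ResidueField R)) ?_ h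
  · refine lt_of_le_of_ne le_top (Ne.symm ?_)
    exact Submodule.top_ne_ideal_smul_of_le_jacobson_annihilator
      ((Ideal.pow_le_self hn).trans (maximalIdeal_le_jacobson _))
  · refine support_residueField.trans ?_
    rw [PrimeSpectrum.zeroLocus_eq_iff, Ideal.radical_pow _ hn]

lemma exists_natCast_eq_ringKrullDim : ∃ d : ℕ, ringKrullDim R = d := by
  obtain ⟨n, hn⟩ := WithBot.ne_bot_iff_exists.mp (ringKrullDim_ne_bot (R := R))
  have h : n ≠ ⊤ := by
    rintro rfl
    exact (ringKrullDim_lt_top (R := R)).ne hn.symm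
  lift n to ℕ using h
  exact ⟨n, hn.symm⟩

omit [IsNoetherianRing R] in
lemma exists_isRegular_of_depth_eq (M : Type v) [AddCommGroup M] [Module R M] [Nontrivial M]
    {d : ℕ} (h : depth R M = d) :
    ∃ rs : List R, rs.length = d ∧ (∀ r ∈ rs, r ∈ maximalIdeal R) ∧ IsRegular M rs := by
  by_contra! hne
  have h1 : ∀ rs : List R, (∀ r ∈ rs, r ∈ maximalIdeal R) → IsRegular M rs →
      rs.length ≤ d - 1 := by
    intro rs mem reg
    have h2 : (rs.length : ℕ∞) ≤ d := by
      rw [← h]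
      exact le_iSup₂_of_le rs ⟨mem, reg⟩ le_rfl
    have h3 : rs.length ≤ d := by exact_mod_cast h2
    have h4 : rs.length ≠ d := fun h ↦ hne rs h mem reg
    lia
  have h2 : depth R M ≤ ((d - 1 : ℕ) : ℕ∞) :=
    iSup₂_le fun rs hrs ↦ by exact_mod_cast h1 rs hrs.1 hrs.2
  rw [h] at h2
  have h3 : d ≤ d - 1 := by exact_mod_cast h2
  -- The subtraction `d - 1` is truncated, so the case `d = 0` survives; there the empty sequence
  -- does the job.
  have h4 : d = 0 := by lia
  exact hne [] h4.symm (by simp) (.nil R M)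

lemma length_le_supportDim_of_isRegular {M : Type v} [AddCommGroup M] [Module R M]
    [Module.Finite R M] (rs : List R) (reg : IsRegular M rs) :
    (rs.length : WithBot ℕ∞) ≤ Module.supportDim R M := by
  rw [← Module.supportDim_add_length_eq_supportDim_of_isRegular rs reg]
  have := reg.quot_ofList_smul_nontrivial ⊤
  obtain ⟨n, hn⟩ := WithBot.ne_bot_iff_exists.mp (Module.supportDim_ne_bot_of_nontrivial R
    (M ⧸ Ideal.ofList rs • (⊤ : Submodule R M)))
  rw [← hn]
  exact_mod_cast le_add_self

lemma depth_eq_of_isRegular {M : Type v} [AddCommGroup M] [Module R M] [Module.Finite R M]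
    (rs : List R) (mem : ∀ r ∈ rs, r ∈ maximalIdeal R) (reg : IsRegular M rs)
    (hd : (rs.length : WithBot ℕ∞) = ringKrullDim R) :
    depth R M = rs.length ∧ Module.supportDim R M = ringKrullDim R := by
  have h1 : Module.supportDim R M = ringKrullDim R :=
    le_antisymm (Module.supportDim_le_ringKrullDim R M) (hd ▸ length_le_supportDim_of_isRegular rs reg)
  refine ⟨le_antisymm (iSup₂_le fun ss hss ↦ ?_) (le_iSup₂_of_le rs ⟨mem, reg⟩ le_rfl), h1⟩
  have := length_le_supportDim_of_isRegular ss hss.2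
  rw [h1, ← hd] at this
  exact_mod_cast this

lemma isCohenMacaulayLocalRing_of_isRegular (rs : List R) (mem : ∀ r ∈ rs, r ∈ maximalIdeal R)
    (reg : IsRegular R rs) (hd : (rs.length : WithBot ℕ∞) = ringKrullDim R) :
    IsCohenMacaulayLocalRing R where
  isNoetherianRing := inferInstance
  depth_eq_ringKrullDim := by
    rw [(depth_eq_of_isRegular rs mem reg hd).1, ← hd]
    rfl

lemma isMaximalCohenMacaulay_of_isRegular {M : Type v} [AddCommGroup M] [Module R M]
    [Module.Finite R M] (rs : List R) (mem : ∀ r ∈ rs, r ∈ maximalIdeal R)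
    (reg : IsRegular M rs) (hd : (rs.length : WithBot ℕ∞) = ringKrullDim R) :
    IsMaximalCohenMacaulay R M where
  finite := inferInstance
  depth_eq_supportDim := by
    rw [(depth_eq_of_isRegular rs mem reg hd).1, (depth_eq_of_isRegular rs mem reg hd).2, ← hd]
    rfl
  supportDim_eq_ringKrullDim := (depth_eq_of_isRegular rs mem reg hd).2

lemma nontrivial_of_isMaximalCohenMacaulay {M : Type v} [AddCommGroup M] [Module R M]
    (hM : IsMaximalCohenMacaulay R M) : Nontrivial M := by
  rw [← Module.supportDim_ne_bot_iff_nontrivial R, hM.supportDim_eq_ringKrullDim]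
  exact ringKrullDim_ne_bot (R := R)

end Depth

/-! ### Associated primes and regular sequences inside a prime -/

section AssociatedPrimes

variable {R : Type u} [CommRing R] [IsLocalRing R] [IsNoetherianRing R]

/-- An element of `q` outside `p` is regular on `R/p`, so dividing by it lowers the dimension by
one, and the result maps onto `R/q`. -/
lemma supportDim_quotient_succ_le_of_lt {p q : Ideal R} [p.IsPrime] [q.IsPrime] (h : p < q) :
    Module.supportDim R (R ⧸ q) + 1 ≤ Module.supportDim R (R ⧸ p) := by
  obtain ⟨x, hxq, hxp⟩ := SetLike.exists_of_lt h
  have hreg : IsSMulRegular (R ⧸ p) x := by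
    intro a b hab
    have hx0 : (Ideal.Quotient.mk p x) ≠ 0 := by
      rwa [Ne, Ideal.Quotient.eq_zero_iff_mem]
    simp only [Algebra.smul_def] at hab
    exact mul_left_cancel₀ hx0 hab
  rw [← Module.supportDim_quotSMulTop_succ_eq_supportDim hreg
    (le_maximalIdeal (Ideal.IsPrime.ne_top ‹_›) hxq)]
  gcongr
  let φ : (R ⧸ p) →ₗ[R] (R ⧸ q) := Submodule.factor h.le
  refine Module.supportDim_le_of_surjective (Submodule.liftQ _ φ ?_) ?_
  · intro y hy
    obtain ⟨z, -, rfl⟩ := (Submodule.mem_smul_pointwise_iff_exists _ _ _).mp hy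
    obtain ⟨z, rfl⟩ := Submodule.mkQ_surjective _ z
    rw [LinearMap.mem_ker, map_smul, Submodule.mkQ_apply]
    change x • (Submodule.Quotient.mk z : R ⧸ q) = 0
    rw [← Submodule.Quotient.mk_smul, Submodule.Quotient.mk_eq_zero]
    exact q.mul_mem_right _ hxq
  · intro y
    obtain ⟨z, rfl⟩ := Submodule.mkQ_surjective _ y
    exact ⟨Submodule.Quotient.mk (Submodule.Quotient.mk z), rfl⟩

/-- The length of a regular sequence on `M` is bounded by the dimension of `R/q` for every
associated prime `q` of `M`. -/
theorem length_le_supportDim_quotient_of_isAssociatedPrime (rs : List R)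
    (mem : ∀ r ∈ rs, r ∈ maximalIdeal R) (M : Type v) [AddCommGroup M] [Module R M]
    [Module.Finite R M] (reg : IsWeaklyRegular M rs) (q : Ideal R)
    (hq : IsAssociatedPrime q M) :
    (rs.length : WithBot ℕ∞) ≤ Module.supportDim R (R ⧸ q) := by
  induction rs generalizing M q with
  | nil =>
    have := hq.isPrime
    obtain ⟨n, hn⟩ := WithBot.ne_bot_iff_exists.mp (Module.supportDim_ne_bot_of_nontrivial R
      (R ⧸ q))
    rw [← hn]
    exact_mod_cast zero_le
  | cons x rs ih =>
    rw [isWeaklyRegular_cons_iff] at reg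
    simp only [List.mem_cons, forall_eq_or_imp] at mem
    have hqp := hq.isPrime
    obtain ⟨-, w, hw⟩ := isAssociatedPrime_iff.mp hq
    have hmem : ∀ r, r ∈ q ↔ r • w = 0 := fun r ↦ by rw [hw]; simp
    have hw0 : w ≠ 0 := by
      rintro rfl
      exact hqp.ne_top ((Ideal.eq_top_iff_one _).mpr ((hmem 1).mpr (by simp)))
    have hxq : x ∉ q := fun h ↦ hw0 (reg.1 (by
      change x • w = x • 0
      rw [(hmem x).mp h, smul_zero]))
    let N := Submodule.torsionBySet R M (q : Set R)
    have hN : ∀ z, z ∈ N ↔ ∀ r ∈ q, r • z = 0 := fun z ↦ by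
      simp [N, Submodule.mem_torsionBySet_iff]
    -- If `N`, the elements killed by `q`, lay inside `xM`, then `N = xN` because `x` is regular,
    -- and Nakayama would give `N = 0` although `w ∈ N`.
    obtain ⟨z, hzN, hzx⟩ : ∃ z ∈ N, z ∉ x • (⊤ : Submodule R M) := by
      by_contra! hcon
      have h1 : N ≤ Ideal.span {x} • N := by
        intro z hz
        obtain ⟨y, -, rfl⟩ := (Submodule.mem_smul_pointwise_iff_exists _ _ _).mp (hcon z hz)
        refine Submodule.smul_mem_smul (Ideal.mem_span_singleton_self x) ?_
        rw [hN] at hz ⊢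
        intro r hr
        apply reg.1
        change x • (r • y) = x • 0
        rw [smul_comm, hz r hr, smul_zero]
      have h2 : N = ⊥ := Submodule.eq_bot_of_le_smul_of_le_jacobson_bot _ N
        (IsNoetherian.noetherian N) h1 (by
          rw [IsLocalRing.jacobson_eq_maximalIdeal ⊥ bot_ne_top, Ideal.span_singleton_le_iff_mem]
          exact mem.1)
      have h3 : w ∈ N := (hN w).mpr fun r hr ↦ (hmem r).mp hr
      rw [h2] at h3
      exact hw0 (by simpa using h3)
    let z' : QuotSMulTop x M := Submodule.Quotient.mk z
    have hz' : z' ≠ 0 := fun h ↦ hzx ((Submodule.Quotient.mk_eq_zero _).mp h)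
    obtain ⟨q', hq', hle⟩ := exists_le_isAssociatedPrime_of_isNoetherianRing R z' hz'
    have hq'p := hq'.isPrime
    have hmem' : ∀ r, r • z' = 0 → r ∈ q' := fun r hr ↦ hle (by simpa using hr)
    -- The class of `z` modulo `x` is killed by `q` and by `x ∉ q`.
    have hqq' : q < q' := by
      refine lt_of_le_of_ne (fun r hr ↦ hmem' r ?_) ?_
      · rw [← Submodule.Quotient.mk_smul, (hN z).mp hzN r hr, Submodule.Quotient.mk_zero]
      · rintro rfl
        refine hxq (hmem' x ?_)
        rw [← Submodule.Quotient.mk_smul, Submodule.Quotient.mk_eq_zero]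
        exact Submodule.smul_mem_pointwise_smul _ _ _ trivial
    have h1 := ih mem.2 _ reg.2 q' hq'
    rw [List.length_cons, Nat.cast_add, Nat.cast_one]
    exact (add_le_add_left h1 1).trans (supportDim_quotient_succ_le_of_lt hqq')

/-- In a prime `p` of a local ring there is a sequence of length at least the height of `p` which
is regular on both `R` and `M`, provided `R` and `M` are maximal Cohen–Macaulay. -/
theorem exists_isWeaklyRegular_height_le {d : ℕ} (hd : ringKrullDim R = d) (M : Type u)
    [AddCommGroup M] [Module R M] [Module.Finite R M]
    (hR : ∀ i < d, ExtVanish R (ResidueField R) R i)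
    (hM : ∀ i < d, ExtVanish R (ResidueField R) M i) (p : Ideal R) [hp : p.IsPrime] :
    ∃ rs : List R, (∀ r ∈ rs, r ∈ p) ∧ IsWeaklyRegular (R × M) rs ∧ p.height ≤ rs.length := by
  have hpm := le_maximalIdeal hp.ne_top
  let P : ℕ → Prop := fun n ↦ ∃ rs : List R, (∀ r ∈ rs, r ∈ p) ∧ IsWeaklyRegular (R × M) rs ∧
    rs.length = n
  have hbound : ∀ rs : List R, (∀ r ∈ rs, r ∈ p) → IsWeaklyRegular (R × M) rs →
      Module.supportDim R (R ⧸ Ideal.ofList rs • (⊤ : Submodule R R)) + rs.length = d := by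
    intro rs mem reg
    have h1 : IsRegular R rs := .of_isWeaklyRegular_of_mem_maximalIdeal _
      (fun r hr ↦ hpm (mem r hr)) (isWeaklyRegular_fst (B := M) reg)
    rw [Module.supportDim_add_length_eq_supportDim_of_isRegular rs h1,
      Module.supportDim_self_eq_ringKrullDim, hd]
  have hPle : ∀ n, P n → n ≤ d := by
    rintro n ⟨rs, mem, reg, rfl⟩
    have h1 := hbound rs mem reg
    have h2 : Module.supportDim R (R ⧸ Ideal.ofList rs • (⊤ : Submodule R R)) ≠ ⊥ := by
      intro h
      rw [h, WithBot.bot_add] at h1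
      exact WithBot.bot_ne_coe h1
    obtain ⟨n, hn⟩ := WithBot.ne_bot_iff_exists.mp h2
    rw [← hn] at h1
    have h3 : n + (rs.length : ℕ∞) = d := by exact_mod_cast h1
    have h4 : (rs.length : ℕ∞) ≤ d := h3 ▸ le_add_self
    exact_mod_cast h4
  classical
  -- Lengths are bounded by `d`, so a sequence of greatest length exists in `p`.
  obtain ⟨n, hn, hmax⟩ : ∃ n, P n ∧ ¬ P (n + 1) := by
    refine ⟨Nat.findGreatest P d, Nat.findGreatest_spec (Nat.zero_le d)
      ⟨[], by simp, by simp, rfl⟩, fun h ↦ ?_⟩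
    have := Nat.le_findGreatest (hPle _ h) h
    lia
  obtain ⟨rs, mem, reg, rfl⟩ := hn
  refine ⟨rs, mem, reg, ?_⟩
  have hlen := hPle _ ⟨rs, mem, reg, rfl⟩
  let Q := (R × M) ⧸ Ideal.ofList rs • (⊤ : Submodule R (R × M))
  have hQreg : IsRegular (R × M) rs := .of_isWeaklyRegular_of_mem_maximalIdeal _
    (fun r hr ↦ hpm (mem r hr)) reg
  have hQ : Nontrivial Q := hQreg.quot_ofList_smul_nontrivial ⊤
  obtain ⟨ss, hss, ssmem, ssreg⟩ := exists_isRegular_of_extVanish Q (d - rs.length) 1 one_ne_zero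
    (extVanish_quotient_ofList rs reg _ fun i hi ↦ .prod (hR i (by lia)) (hM i (by lia)))
  rw [pow_one] at ssmem
  -- By maximality `p` consists of zero divisors on `Q`; prime avoidance puts it inside an
  -- associated prime.
  obtain ⟨q, hq, hpq⟩ : ∃ q ∈ associatedPrimes R Q, p ≤ q := by
    refine (Ideal.subset_union_prime_finite (associatedPrimes.finite R Q) p p
      fun I hI _ _ ↦ IsAssociatedPrime.isPrime hI).mp ?_
    rw [biUnion_associatedPrimes_eq_compl_regular R Q]
    intro x hx hxreg
    refine hmax ⟨rs ++ [x], ?_, ?_, by simp⟩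
    · intro r hr
      rcases List.mem_append.mp hr with hr | hr
      · exact mem r hr
      · rw [List.mem_singleton.mp hr]
        exact hx
    · rw [isWeaklyRegular_append_iff]
      exact ⟨reg, (isWeaklyRegular_singleton_iff _ x).mpr hxreg⟩
  have hq1 := length_le_supportDim_quotient_of_isAssociatedPrime ss ssmem Q ssreg.1 q hq
  rw [hss] at hq1
  have hqp : q.IsPrime := IsAssociatedPrime.isPrime hq
  -- A smaller prime `p'` over `rs` would give `dim R/p' ≥ dim R/q + 1 > d - length = dim R/(rs)`.
  -- Krull's height theorem then bounds the height of `p`.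
  have hmin : p ∈ (Ideal.ofList rs).minimalPrimes := by
    refine ⟨⟨hp, Ideal.span_le.mpr mem⟩, fun p' ⟨hp', hle⟩ hp'p ↦ ?_⟩
    by_contra hne
    have hlt : p' < q := lt_of_lt_of_le (lt_of_le_not_ge hp'p hne) hpq
    have h1 := supportDim_quotient_succ_le_of_lt hlt
    have h2 : Module.supportDim R (R ⧸ p') ≤
        Module.supportDim R (R ⧸ Ideal.ofList rs • (⊤ : Submodule R R)) :=
      Module.supportDim_le_of_surjective (Submodule.factor (by simpa using hle))
        (Submodule.factor_surjective _)
    have h3 : ((d - rs.length : ℕ) : WithBot ℕ∞) + 1 + rs.length ≤ d := by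
      rw [← hbound rs mem reg]
      gcongr
      exact (add_le_add_left hq1 1).trans (h1.trans h2)
    have h4 : d - rs.length + 1 + rs.length ≤ d := by exact_mod_cast h3
    lia
  have h1 : Ideal.ofList rs = Ideal.span (rs.toFinset : Set R) := by
    simp [Ideal.ofList]
  rw [h1] at hmin
  refine (Ideal.height_le_card_of_mem_minimalPrimes_span_finset hmin).trans ?_
  exact_mod_cast List.toFinset_card_le rs

end AssociatedPrimes

/-! ### Maximal Cohen–Macaulay modules of finite injective dimension -/

section FiniteInjectiveDimension

variable {R : Type u} [CommRing R] [IsLocalRing R] [IsNoetherianRing R]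

lemma isArtinianRing_quotient_ofList (rs : List R) (reg : IsRegular R rs)
    (hd : ringKrullDim R = rs.length) : IsArtinianRing (R ⧸ Ideal.ofList rs) := by
  have h1 := ringKrullDim_add_length_eq_ringKrullDim_of_isRegular rs reg
  rw [hd] at h1
  rw [isArtinianRing_iff_isNoetherianRing_krullDimLE_zero]
  refine ⟨inferInstance, Ring.krullDimLE_iff.mpr ?_⟩
  generalize ringKrullDim (R ⧸ Ideal.ofList rs) = D at h1
  cases D with
  | bot => exact bot_le
  | coe n =>
    have h2 : n + (rs.length : ℕ∞) = rs.length := by exact_mod_cast h1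
    have h3 : n ≠ ⊤ := by
      rintro rfl
      simp at h2
    lift n to ℕ using h3
    have h4 : n + rs.length = rs.length := by exact_mod_cast h2
    have h5 : n = 0 := by lia
    rw [h5]
    rfl

lemma isFiniteLength_quotient_ofList (rs : List R) (reg : IsRegular R rs)
    (hd : ringKrullDim R = rs.length) (M : Type v) [AddCommGroup M] [Module R M]
    [Module.Finite R M] : IsFiniteLength R (M ⧸ Ideal.ofList rs • (⊤ : Submodule R M)) := by
  have := isArtinianRing_quotient_ofList rs reg hd
  have : Module.Finite (R ⧸ Ideal.ofList rs) (M ⧸ Ideal.ofList rs • (⊤ : Submodule R M)) :=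
    .of_restrictScalars_finite R _ _
  have : IsArtinian R (M ⧸ Ideal.ofList rs • (⊤ : Submodule R M)) :=
    isArtinian_of_surjective_algebraMap (R := R ⧸ Ideal.ofList rs) Ideal.Quotient.mk_surjective
  exact isFiniteLength_iff_isNoetherian_isArtinian.mpr ⟨inferInstance, inferInstance⟩

variable {ω : Type u} [AddCommGroup ω] [Module R ω] [Module.Finite R ω]
  (hω : ∃ n : ℕ, HasInjectiveDimensionLE (ModuleCat.of R ω) n)

include hω

/-- The ring `R/(rs)` is Artinian and nonzero, so it contains the copy of `k` that the general
vanishing theorem requires. -/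
lemma extVanish_of_ringKrullDim_lt (rs : List R) (reg : IsRegular R rs)
    (hd : ringKrullDim R = rs.length) (N : Type u) [AddCommGroup N] [Module R N]
    [Module.Finite R N] (i : ℕ) (hi : rs.length < i) : ExtVanish R N ω i := by
  have := isArtinianRing_quotient_ofList rs reg hd
  have : IsArtinian R (R ⧸ Ideal.ofList rs) :=
    isArtinian_of_surjective_algebraMap (R := R ⧸ Ideal.ofList rs) Ideal.Quotient.mk_surjective
  have : Nontrivial (R ⧸ Ideal.ofList rs) := by
    rw [Ideal.Quotient.nontrivial_iff]
    simpa using reg.2.symm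
  obtain ⟨ι, hι⟩ := exists_residueField_injective (R := R) (E := R ⧸ Ideal.ofList rs)
  exact extVanish_of_hasInjectiveDimensionLE hω rs reg ι hι N i hi

lemma isInjectiveModulo_of_ringKrullDim_eq (rs : List R) (reg : IsRegular R rs)
    (hd : ringKrullDim R = rs.length) (regω : IsWeaklyRegular ω rs) :
    IsInjectiveModulo (Ideal.ofList rs) (ω ⧸ Ideal.ofList rs • (⊤ : Submodule R ω)) :=
  isInjectiveModulo_quotient_ofList rs regω fun N _ _ _ ↦
    extVanish_of_ringKrullDim_lt hω rs reg hd N _ (Nat.lt_succ_self _)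

/-- A sequence of length `dim R` on `N` lowers the vanishing range from degrees above `dim R` to all
positive degrees. -/
lemma extVanish_succ_of_isWeaklyRegular (rs : List R) (mem : ∀ r ∈ rs, r ∈ maximalIdeal R)
    (reg : IsRegular R rs) (hd : ringKrullDim R = rs.length) (N : Type u) [AddCommGroup N]
    [Module R N] [Module.Finite R N] (regN : IsWeaklyRegular N rs) (i : ℕ) :
    ExtVanish R N ω (i + 1) :=
  extVanish_of_isWeaklyRegular_left
    (fun N _ _ _ i hi ↦ extVanish_of_ringKrullDim_lt hω rs reg hd N i hi) rs mem N regN (i + 1)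
    (by lia)

/-- A maximal Cohen–Macaulay module of finite injective dimension over a Cohen–Macaulay local
ring is faithful. -/
theorem annihilator_eq_bot_of_hasInjectiveDimensionLE [Nontrivial ω] {d : ℕ}
    (hd : ringKrullDim R = d)
    (vR : ∀ i < d, ExtVanish R (ResidueField R) R i)
    (vω : ∀ i < d, ExtVanish R (ResidueField R) ω i) : Module.annihilator R ω = ⊥ := by
  rw [← le_bot_iff, ← Ideal.iInf_pow_eq_bot_of_isLocalRing (maximalIdeal R)
    (maximalIdeal.isMaximal R).ne_top]
  refine le_iInf fun n ↦ ?_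
  -- With `rs` inside `𝔪^(n+1)`, the annihilator of `ω` kills `ω/(rs)ω`, hence lies in `(rs) ⊆ 𝔪^n`;
  -- Krull's intersection theorem concludes.
  obtain ⟨rs, rfl, mem, reg⟩ := exists_isRegular_of_extVanish (R × ω) d (n + 1) (by simp)
    fun i hi ↦ .prod (vR i hi) (vω i hi)
  have mem' : ∀ r ∈ rs, r ∈ maximalIdeal R := fun r hr ↦ Ideal.pow_le_self (by simp) (mem r hr)
  have regR : IsRegular R rs := .of_isWeaklyRegular_of_mem_maximalIdeal _ mem'
    (isWeaklyRegular_fst (B := ω) reg.1)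
  have regω : IsRegular ω rs := .of_isWeaklyRegular_of_mem_maximalIdeal _ mem'
    (isWeaklyRegular_snd (A := R) reg.1)
  have hinj := isInjectiveModulo_of_ringKrullDim_eq hω rs regR hd regω.1
  have := regω.quot_ofList_smul_nontrivial ⊤
  obtain ⟨_, _⟩ := isFiniteLength_iff_isNoetherian_isArtinian.mp
    (isFiniteLength_quotient_ofList rs regR hd ω)
  refine (LinearMap.annihilator_le_of_surjective _ (Submodule.mkQ_surjective _)).trans
    ((annihilator_le_of_isInjectiveModulo hinj).trans ?_)
  exact (Ideal.span_le.mpr mem).trans (Ideal.pow_le_pow_right (Nat.le_succ n))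

omit hω [Module.Finite R ω] [IsNoetherianRing R] in
lemma length_hom_quotient_eq_cmType (rs : List R) (mem : ∀ r ∈ rs, r ∈ maximalIdeal R)
    (regω : IsWeaklyRegular ω rs) (hdepth : depth R ω = rs.length) :
    Module.length R (ResidueField R →ₗ[R] ω ⧸ Ideal.ofList rs • (⊤ : Submodule R ω)) =
      cmType R ω := by
  obtain ⟨e⟩ := nonempty_linearEquiv_hom_quotient_ext (N := ResidueField R) rs regω
    fun r hr ↦ mem_annihilator_residueField (mem r hr)
  rw [e.length_eq, cmType, hdepth]
  rfl

end FiniteInjectiveDimension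

/-! ### Endomorphisms and uniqueness of canonical modules -/

section Canonical

variable {R : Type u} [CommRing R] [IsLocalRing R]

/-- A Cohen–Macaulay local ring has vanishing `Ext^i(k, R)` below its dimension. -/
lemma IsCohenMacaulayLocalRing.extVanish (hR : IsCohenMacaulayLocalRing R) {d : ℕ}
    (hd : ringKrullDim R = d) (i : ℕ) (hi : i < d) : ExtVanish R (ResidueField R) R i := by
  have h := hR.depth_eq_ringKrullDim
  rw [hd] at h
  obtain ⟨rs, rfl, mem, reg⟩ := exists_isRegular_of_depth_eq R (d := d) (by exact_mod_cast h)
  exact extVanish_residueField rs mem reg.1 i hi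

variable {ω : Type u} [AddCommGroup ω] [Module R ω]

lemma IsMaximalCohenMacaulay.depth_eq (hω : IsMaximalCohenMacaulay R ω) {d : ℕ}
    (hd : ringKrullDim R = d) : depth R ω = d := by
  have h := hω.depth_eq_supportDim
  rw [hω.supportDim_eq_ringKrullDim, hd] at h
  exact_mod_cast h

lemma IsMaximalCohenMacaulay.extVanish [IsNoetherianRing R] (hω : IsMaximalCohenMacaulay R ω) {d : ℕ}
    (hd : ringKrullDim R = d) (i : ℕ) (hi : i < d) : ExtVanish R (ResidueField R) ω i := by
  have := nontrivial_of_isMaximalCohenMacaulay hω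
  obtain ⟨rs, rfl, mem, reg⟩ := exists_isRegular_of_depth_eq ω (hω.depth_eq hd)
  exact extVanish_residueField rs mem reg.1 i hi

/-- Every endomorphism of a canonical module is a homothety. -/
theorem IsCanonicalModule.exists_eq_smul_id (hR : IsCohenMacaulayLocalRing R)
    (hω : IsCanonicalModule R ω) (f : ω →ₗ[R] ω) : ∃ c : R, f = c • LinearMap.id := by
  have := hR.isNoetherianRing
  have := hω.isMaximalCohenMacaulay.finite
  obtain ⟨d, hd⟩ := exists_natCast_eq_ringKrullDim (R := R)
  obtain ⟨rs, rfl, mem, reg⟩ := exists_isRegular_of_extVanish (R × ω) d 1 one_ne_zero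
    fun i hi ↦ .prod (hR.extVanish hd i hi) (hω.isMaximalCohenMacaulay.extVanish hd i hi)
  rw [pow_one] at mem
  have regR : IsRegular R rs := .of_isWeaklyRegular_of_mem_maximalIdeal _ mem
    (isWeaklyRegular_fst (B := ω) reg.1)
  have regω := isWeaklyRegular_snd (A := R) reg.1
  have hv := extVanish_succ_of_isWeaklyRegular hω.finite_injectiveDimension rs mem regR hd ω regω
  have htype := length_hom_quotient_eq_cmType rs mem regω
    (hω.isMaximalCohenMacaulay.depth_eq hd)
  rw [hω.type_eq_one] at htype
  let S : Submodule R (ω →ₗ[R] ω) := (LinearMap.toSpanSingleton R _ LinearMap.id).range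
  -- Nakayama for `End ω`: modulo `rs` an endomorphism is a homothety, and a difference with values
  -- in `(rs)ω` lies in `(rs) End ω`.
  have hS : ⊤ ≤ S := by
    refine Submodule.le_of_le_smul_of_le_jacobson_bot (I := Ideal.ofList rs)
      (IsNoetherian.noetherian _) ?_ ?_
    · rw [IsLocalRing.jacobson_eq_maximalIdeal ⊥ bot_ne_top]
      exact Ideal.span_le.mpr mem
    · intro g _
      let W := Ideal.ofList rs • (⊤ : Submodule R ω)
      obtain ⟨c, hc⟩ := exists_eq_smul_id_of_length_hom_le htype.le
        (isFiniteLength_quotient_ofList rs regR hd ω)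
        (W.mapQ W g (Submodule.smul_top_le_comap_smul_top _ g))
      have h1 : g = c • LinearMap.id + (g - c • LinearMap.id) := by abel
      rw [h1]
      refine Submodule.add_mem_sup ⟨c, rfl⟩ (mem_ofList_smul_hom rs regω hv _ fun n ↦ ?_)
      have h2 := LinearMap.congr_fun hc (W.mkQ n)
      rw [← Submodule.Quotient.mk_eq_zero]
      have h3 : (Submodule.Quotient.mk (g n) : ω ⧸ W) = c • Submodule.Quotient.mk n := h2
      rw [LinearMap.sub_apply, Submodule.Quotient.mk_sub, h3, sub_eq_zero]
      rfl
  obtain ⟨c, hc⟩ := hS (Submodule.mem_top (x := f))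
  exact ⟨c, hc.symm⟩

/-- A maximal Cohen–Macaulay module of finite injective dimension all of whose endomorphisms are
homotheties is canonical. -/
theorem isCanonicalModule_of_forall_eq_smul_id (hR : IsCohenMacaulayLocalRing R)
    (hω : IsMaximalCohenMacaulay R ω)
    (hinj : ∃ n : ℕ, HasInjectiveDimensionLE (ModuleCat.of R ω) n)
    (hend : ∀ f : ω →ₗ[R] ω, ∃ c : R, f = c • LinearMap.id) : IsCanonicalModule R ω where
  isMaximalCohenMacaulay := hω
  finite_injectiveDimension := hinj
  type_eq_one := by
    have := hR.isNoetherianRing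
    have := hω.finite
    obtain ⟨d, hd⟩ := exists_natCast_eq_ringKrullDim (R := R)
    obtain ⟨rs, rfl, mem, reg⟩ := exists_isRegular_of_extVanish (R × ω) d 1 one_ne_zero
      fun i hi ↦ .prod (hR.extVanish hd i hi) (hω.extVanish hd i hi)
    rw [pow_one] at mem
    have regR : IsRegular R rs := .of_isWeaklyRegular_of_mem_maximalIdeal _ mem
      (isWeaklyRegular_fst (B := ω) reg.1)
    have := nontrivial_of_isMaximalCohenMacaulay hω
    have regω : IsRegular ω rs := .of_isWeaklyRegular_of_mem_maximalIdeal _ mem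
      (isWeaklyRegular_snd (A := R) reg.1)
    have hv := extVanish_succ_of_isWeaklyRegular hinj rs mem regR hd ω regω.1
    rw [← length_hom_quotient_eq_cmType rs mem regω.1 (hω.depth_eq hd)]
    have := regω.quot_ofList_smul_nontrivial ⊤
    obtain ⟨_, _⟩ := isFiniteLength_iff_isNoetherian_isArtinian.mp
      (isFiniteLength_quotient_ofList rs regR hd ω)
    refine length_hom_residueField_eq_one (le_annihilator_quotient_smul_top _ ω)
      (isInjectiveModulo_of_ringKrullDim_eq hinj rs regR hd regω.1) fun f ↦ ?_
    -- Every endomorphism of `ω/(rs)ω` lifts to `ω`, so it inherits the property of being a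
    -- homothety.
    obtain ⟨g, hg⟩ := exists_lift_quotient_ofList rs regω.1 hv (f ∘ₗ Submodule.mkQ _)
    obtain ⟨c, rfl⟩ := hend g
    refine ⟨c, Submodule.linearMap_qext _ ?_⟩
    rw [← hg]
    rfl

variable {ω' : Type u} [AddCommGroup ω'] [Module R ω']

/-- Any canonical module maps onto any other one. -/
theorem IsCanonicalModule.exists_surjective (hR : IsCohenMacaulayLocalRing R)
    (hω : IsCanonicalModule R ω) (hω' : IsCanonicalModule R ω') :
    ∃ f : ω →ₗ[R] ω', Function.Surjective f := by
  have := hR.isNoetherianRing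
  have := hω.isMaximalCohenMacaulay.finite
  have := hω'.isMaximalCohenMacaulay.finite
  obtain ⟨d, hd⟩ := exists_natCast_eq_ringKrullDim (R := R)
  obtain ⟨rs, rfl, mem, reg⟩ := exists_isRegular_of_extVanish (R × (ω × ω')) d 1 one_ne_zero
    fun i hi ↦ .prod (hR.extVanish hd i hi) (.prod (hω.isMaximalCohenMacaulay.extVanish hd i hi)
      (hω'.isMaximalCohenMacaulay.extVanish hd i hi))
  rw [pow_one] at mem
  have regR : IsRegular R rs := .of_isWeaklyRegular_of_mem_maximalIdeal _ mem
    (isWeaklyRegular_fst (B := ω × ω') reg.1)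
  have regω := isWeaklyRegular_fst (isWeaklyRegular_snd (A := R) reg.1)
  have regω' := isWeaklyRegular_snd (isWeaklyRegular_snd (A := R) reg.1)
  have hv := extVanish_succ_of_isWeaklyRegular hω'.finite_injectiveDimension rs mem regR hd ω regω
  have htype := length_hom_quotient_eq_cmType rs mem regω
    (hω.isMaximalCohenMacaulay.depth_eq hd)
  have htype' := length_hom_quotient_eq_cmType rs mem regω'
    (hω'.isMaximalCohenMacaulay.depth_eq hd)
  rw [hω.type_eq_one] at htype
  rw [hω'.type_eq_one] at htype'
  obtain ⟨g, hg⟩ := exists_surjective_of_isInjectiveModulo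
    (isFiniteLength_quotient_ofList rs regR hd ω) (isFiniteLength_quotient_ofList rs regR hd ω')
    (le_annihilator_quotient_smul_top _ ω) (le_annihilator_quotient_smul_top _ ω') htype htype'
    (isInjectiveModulo_of_ringKrullDim_eq hω.finite_injectiveDimension rs regR hd regω)
    (isInjectiveModulo_of_ringKrullDim_eq hω'.finite_injectiveDimension rs regR hd regω')
  -- A surjection modulo `rs` lifts to a map `ω → ω'`, which is surjective by Nakayama.
  obtain ⟨f, hf⟩ := exists_lift_quotient_ofList rs regω' hv (g ∘ₗ Submodule.mkQ _)
  refine ⟨f, LinearMap.range_eq_top.mp (top_le_iff.mp ?_)⟩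
  refine Submodule.le_of_le_smul_of_le_jacobson_bot (I := Ideal.ofList rs)
    (IsNoetherian.noetherian _) ?_ ?_
  · rw [IsLocalRing.jacobson_eq_maximalIdeal ⊥ bot_ne_top]
    exact Ideal.span_le.mpr mem
  · intro y _
    obtain ⟨x, hx⟩ := (hg.comp (Submodule.mkQ_surjective _)) (Submodule.Quotient.mk y)
    have h1 : Submodule.Quotient.mk (f x) = _ := (LinearMap.congr_fun hf x).trans hx
    have h2 : y = f x + (y - f x) := by abel
    rw [h2]
    refine Submodule.add_mem_sup ⟨x, rfl⟩ ?_
    rw [← Submodule.Quotient.mk_eq_zero, Submodule.Quotient.mk_sub, h1, sub_self]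

end Canonical

/-! ### Traces under surjections and localization -/

section Trace

variable {R : Type u} [CommRing R] {M N : Type v} [AddCommGroup M] [Module R M]
  [AddCommGroup N] [Module R N]

lemma traceIdeal_le_of_surjective (f : M →ₗ[R] N) (hf : Function.Surjective f) :
    traceIdeal R N ≤ traceIdeal R M :=
  iSup_le fun φ ↦ le_iSup_of_le (φ ∘ₗ f) <| by
    rw [LinearMap.range_comp_of_range_eq_top _ (LinearMap.range_eq_top.mpr hf)]

theorem traceIdeal_localizedModule [Module.FinitePresentation R M] (S : Submonoid R) :
    traceIdeal (Localization S) (LocalizedModule S M) =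
      (traceIdeal R M).map (algebraMap R (Localization S)) := by
  let ℓ := LocalizedModule.mkLinearMap S M
  apply le_antisymm
  · refine iSup_le fun φ ↦ ?_
    -- Finite presentation: up to the unit `s`, `φ` comes from a map `M → R`.
    obtain ⟨ψ, s, hψ⟩ := Module.FinitePresentation.exists_lift_of_isLocalizedModule S
      (Algebra.linearMap R (Localization S)) (φ.restrictScalars R ∘ₗ ℓ)
    rintro _ ⟨x, rfl⟩
    obtain ⟨⟨m, t⟩, rfl⟩ := IsLocalizedModule.mk'_surjective S ℓ x
    have h1 : algebraMap R (Localization S) (ψ m) = algebraMap R (Localization S) s * φ (ℓ m) := by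
      have := LinearMap.congr_fun hψ m
      rw [← Algebra.smul_def]
      exact this
    have h2 : algebraMap R (Localization S) (ψ m) ∈
        (traceIdeal R M).map (algebraMap R (Localization S)) :=
      Ideal.mem_map_of_mem _ ((le_iSup (fun φ : M →ₗ[R] R ↦ LinearMap.range φ) ψ) ⟨m, rfl⟩)
    have h3 : algebraMap R (Localization S) t * φ (IsLocalizedModule.mk' ℓ m t) = φ (ℓ m) := by
      rw [← smul_eq_mul, ← map_smul, algebraMap_smul]
      congr 1
      exact IsLocalizedModule.mk'_cancel' ℓ m t
    rw [h1, ← h3, Ideal.unit_mul_mem_iff_mem _ (IsLocalization.map_units _ s),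
      Ideal.unit_mul_mem_iff_mem _ (IsLocalization.map_units _ t)] at h2
    exact h2
  · rw [Ideal.map_le_iff_le_comap]
    refine iSup_le fun φ ↦ ?_
    rintro _ ⟨m, rfl⟩
    refine (le_iSup (fun φ : LocalizedModule S M →ₗ[Localization S] Localization S ↦
      LinearMap.range φ) (IsLocalizedModule.mapExtendScalars S ℓ
        (Algebra.linearMap R (Localization S)) (Localization S) φ)) ⟨ℓ m, ?_⟩
    exact IsLocalizedModule.map_apply S ℓ (Algebra.linearMap R (Localization S)) φ m

end Trace

/-! ### Localization of canonical modules -/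

section Localization

variable {R : Type u} [CommRing R]

lemma exists_eq_smul_id_localizedModule {M : Type u} [AddCommGroup M] [Module R M]
    [Module.FinitePresentation R M] (S : Submonoid R)
    (h : ∀ f : M →ₗ[R] M, ∃ c : R, f = c • LinearMap.id)
    (f : LocalizedModule S M →ₗ[Localization S] LocalizedModule S M) :
    ∃ c : Localization S, f = c • LinearMap.id := by
  let ℓ := LocalizedModule.mkLinearMap S M
  obtain ⟨g, s, hg⟩ := Module.FinitePresentation.exists_lift_of_isLocalizedModule S ℓ
    (f.restrictScalars R ∘ₗ ℓ)
  obtain ⟨c, rfl⟩ := h g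
  refine ⟨IsLocalization.mk' _ c s, LinearMap.restrictScalars_injective R ?_⟩
  refine IsLocalizedModule.linearMap_ext S ℓ ℓ (LinearMap.ext fun m ↦ ?_)
  have h1 : c • ℓ m = s • f (ℓ m) :=
    (ℓ.map_smul c m).symm.trans (LinearMap.congr_fun hg m)
  apply IsLocalizedModule.smul_injective ℓ s
  change s • f (ℓ m) = s • (IsLocalization.mk' (Localization S) c s • ℓ m)
  rw [← h1, Submonoid.smul_def, ← algebraMap_smul (Localization S) (s : R), smul_smul,
    IsLocalization.mk'_spec', algebraMap_smul]

lemma hasInjectiveDimensionLE_localizedModule [IsNoetherianRing R] {M : Type u} [AddCommGroup M]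
    [Module R M] (S : Submonoid R) {n : ℕ} (h : HasInjectiveDimensionLE (ModuleCat.of R M) n) :
    HasInjectiveDimensionLE (ModuleCat.of (Localization S) (LocalizedModule S M)) n := by
  have h1 := ModuleCat.localizedModule_hasInjectiveDimensionLE n S (ModuleCat.of R M)
  exact (ModuleCat.hasInjectiveDimensionLE_iff_of_linearEquiv
    (Shrink.linearEquiv (Localization S) (LocalizedModule S M)) n).mp h1

variable [IsLocalRing R]

/-- Canonical modules localize. -/
theorem IsCanonicalModule.localization {ω : Type u} [AddCommGroup ω] [Module R ω]
    (hR : IsCohenMacaulayLocalRing R) (hω : IsCanonicalModule R ω) (p : Ideal R) [p.IsPrime] :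
    IsCohenMacaulayLocalRing (Localization.AtPrime p) ∧
      IsCanonicalModule (Localization.AtPrime p) (LocalizedModule p.primeCompl ω) := by
  have := hR.isNoetherianRing
  have := hω.isMaximalCohenMacaulay.finite
  have := nontrivial_of_isMaximalCohenMacaulay hω.isMaximalCohenMacaulay
  have : Module.FinitePresentation R ω := Module.finitePresentation_of_finite R ω
  obtain ⟨d, hd⟩ := exists_natCast_eq_ringKrullDim (R := R)
  have vR := hR.extVanish hd
  have vω := hω.isMaximalCohenMacaulay.extVanish hd
  have hann := annihilator_eq_bot_of_hasInjectiveDimensionLE hω.finite_injectiveDimension hd vR vω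
  -- A finite faithful module has full support.
  have hntr : Nontrivial (LocalizedModule p.primeCompl ω) := by
    have h1 : (⟨p, ‹_›⟩ : PrimeSpectrum R) ∈ Module.support R ω := by
      rw [Module.mem_support_iff_of_finite, hann]
      exact bot_le
    exact Module.mem_support_iff.mp h1
  obtain ⟨rs, mem, reg, hlen⟩ := exists_isWeaklyRegular_height_le hd ω vR vω p
  let A := Localization.AtPrime p
  have : IsNoetherianRing A := IsLocalization.isNoetherianRing p.primeCompl A inferInstance
  have : Module.Finite A (LocalizedModule p.primeCompl ω) := inferInstance
  have regA : IsRegular A (rs.map (algebraMap R A)) :=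
    (isWeaklyRegular_fst (B := ω) reg).isRegular_of_isLocalization_of_mem A p mem
  have regM : IsRegular (LocalizedModule p.primeCompl ω) (rs.map (algebraMap R A)) :=
    (isWeaklyRegular_snd (A := R) reg).isRegular_of_isLocalizedModule_of_mem A p
      (LocalizedModule.mkLinearMap p.primeCompl ω) mem
  have memA : ∀ r ∈ rs.map (algebraMap R A), r ∈ maximalIdeal A := by
    intro r hr
    obtain ⟨r, hr', rfl⟩ := List.mem_map.mp hr
    exact (IsLocalization.AtPrime.to_map_mem_maximal_iff A p r).mpr (mem r hr')
  -- A regular sequence is no longer than `dim R_p`, which is the height of `p`; the choice of `rs`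
  -- gives the other inequality.
  have hdim : ((rs.map (algebraMap R A)).length : WithBot ℕ∞) = ringKrullDim A := by
    apply le_antisymm
    · rw [← Module.supportDim_self_eq_ringKrullDim]
      exact length_le_supportDim_of_isRegular _ regA
    · rw [IsLocalization.AtPrime.ringKrullDim_eq_height p A, List.length_map]
      exact_mod_cast hlen
  have hA := isCohenMacaulayLocalRing_of_isRegular _ memA regA hdim
  obtain ⟨n, hn⟩ := hω.finite_injectiveDimension
  exact ⟨hA, isCanonicalModule_of_forall_eq_smul_id hA
    (isMaximalCohenMacaulay_of_isRegular _ memA regM hdim)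
    ⟨n, hasInjectiveDimensionLE_localizedModule p.primeCompl hn⟩
    (exists_eq_smul_id_localizedModule p.primeCompl (hω.exists_eq_smul_id hR))⟩

lemma bijective_algebraMap_localization_maximalIdeal :
    Function.Bijective (algebraMap R (Localization.AtPrime (maximalIdeal R))) :=
  (IsLocalization.atUnits R (maximalIdeal R).primeCompl (S := Localization.AtPrime (maximalIdeal R))
    fun x hx ↦ by simpa [IsUnit.mem_submonoid_iff] using hx).bijective

end Localization

end CanonicalTrace

/-! ### The criterion for CTR -/

theorem proposition3p2 {R : Type u} [CommRing R] [IsLocalRing R]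
    (hR : CanonicalTrace.IsCohenMacaulayLocalRing R)
    (ω : Type u) [AddCommGroup ω] [Module R ω] (hω : CanonicalTrace.IsCanonicalModule R ω) :
    CanonicalTrace.IsCTR R ↔ (CanonicalTrace.traceIdeal R ω).IsRadical := by
  have := hR.isNoetherianRing
  have := hω.isMaximalCohenMacaulay.finite
  have : Module.FinitePresentation R ω := Module.finitePresentation_of_finite R ω
  constructor
  · intro h
    let m := IsLocalRing.maximalIdeal R
    obtain ⟨ω', _, _, hω', hrad⟩ := h.exists_canonicalModule m
    obtain ⟨hA, hωm⟩ := hω.localization hR m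
    -- The module `ω'` supplied by CTR is arbitrary; surjections both ways identify its trace with
    -- that of the localized `ω`.
    obtain ⟨f, hf⟩ := hωm.exists_surjective hA hω'
    obtain ⟨g, hg⟩ := hω'.exists_surjective hA hωm
    have h1 := le_antisymm (CanonicalTrace.traceIdeal_le_of_surjective f hf)
      (CanonicalTrace.traceIdeal_le_of_surjective g hg)
    rw [h1, CanonicalTrace.traceIdeal_localizedModule] at hrad
    have h2 := hrad.comap (algebraMap R (Localization.AtPrime m))
    rwa [Ideal.comap_map_of_bijective _
      CanonicalTrace.bijective_algebraMap_localization_maximalIdeal] at h2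
  · intro hrad
    refine ⟨⟨inferInstance, fun p _ ↦ (hω.localization hR p).1⟩, fun p _ ↦
      ⟨LocalizedModule p.primeCompl ω, inferInstance, inferInstance,
        (hω.localization hR p).2, ?_⟩⟩
    rw [CanonicalTrace.traceIdeal_localizedModule, ← Ideal.radical_eq_iff,
      ← IsLocalization.map_radical p.primeCompl, hrad.radical]
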